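/- Let $d\ge 1$ be an integer and let $|\cdot|$ be the Euclidean norm on $\mathbb R^d$. For a Borel probability measure $\mu$ on $\mathbb R^d$ and $0<q<\infty$ let $\mathcal M_q(\mu)=\int_{\mathbb R^d}|x|^q\,\mu(dx)$; for $q=\infty$ let $\mathcal M_\infty(\mu)^{1/\infty}$ denote the $\mu$-essential supremum of $|x|$. Let $\mathcal P_q(\mathbb R^d)$ be the set of Borel probability measures $\mu$ on $\mathbb R^d$ with $\mathcal M_q(\mu)^{1/q}<\infty$. For $p>0$ let \[ \mathcal W_p(\mu,\nu)=\inf_{\gamma}\Big(\iint_{\mathbb R^d\times\mathbb R^d}|x-y|^p\,\gamma(dx,dy)\Big)^{1/p}, \] the infimum being over all probability measures $\gamma$ on $\mathbb R^d\times\mathbb R^d$ with marginals $\mu$ and $\nu$, and let \[ e_{N;d,p}(\mu)=\inf_{x_1,\dots,x_N\in\mathbb R^d}\mathcal W_p\Big(\mu,\frac1N\sum_{i=1}^N\delta_{x_i}\Big). \] Let $0<p<q\le\infty$, where for $q=\infty$ we read $\frac{pq}{q-p}=p$ and $\frac1q=0$. Then there is a constant $C=C_{d,p,q}>0$ such that,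 for all $N\ge1$ and all $\mu\in\mathcal P_q(\mathbb R^d)$, \[ e_{N;d,p}(\mu)\le C\,\mathcal M_q(\mu)^{1/q}\times \begin{cases} \max\big(N^{-1/d},\,N^{-1/p+1/q}\big) & \text{if } d\ne\frac{pq}{q-p},\\[2pt] N^{-1/d}\,\log(1+N)^{1/d} & \text{if } d=\frac{pq}{q-p}. \end{cases} \] Moreover, if $q<\infty$ and $d<\frac{pq}{q-p}$, then for every $\mu\in\mathcal P_q(\mathbb R^d)$, \[ \lim_{N\to\infty}N^{1/p-1/q}\,e_{N;d,p}(\mu)=0 . \] -/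

import Mathlib

open MeasureTheory Filter Topology
open scoped ENNReal

noncomputable section

namespace UniformQuantization

/-- Euclidean space `ℝ^d`, with the Euclidean norm. -/
abbrev Space (d : ℕ) : Type := EuclideanSpace ℝ (Fin d)

/-- `M_q(μ)^{1/q}`: it is `(∫ |x|^q μ(dx))^{1/q}` for `0 < q < ∞`, and, for `q = ∞`, the
`μ`-essential supremum of `|x|`, i.e. the radius of the smallest closed ball centred at the origin
that carries `μ`. -/
def momentRoot {d : ℕ} (q : ℝ≥0∞) (μ : Measure (Space d)) : ℝ≥0∞ :=
  eLpNorm (fun x : Space d => x) q μ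

/-- `𝒫_q(ℝ^d)`: the Borel probability measures on `ℝ^d` with finite moment of order `q`
(for `q = ∞`: with bounded support). -/
def FiniteMoment (d : ℕ) (q : ℝ≥0∞) : Set (Measure (Space d)) :=
  {μ | IsProbabilityMeasure μ ∧ momentRoot q μ < ∞}

/-- `Γ(μ, ν)`: the measures on the product with marginals `μ` and `ν` (they are probability
measures as soon as `μ` is one). -/
def couplings {d : ℕ} (μ ν : Measure (Space d)) : Set (Measure (Space d × Space d)) :=
  {γ | γ.map Prod.fst = μ ∧ γ.map Prod.snd = ν}

/-- The `p`-Wasserstein distance, for any real `p > 0`: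
`inf_γ (∬ |x - y|^p γ(dx, dy))^{1/p}` over all couplings `γ` of `μ` and `ν`. -/
def wasserstein {d : ℕ} (p : ℝ) (μ ν : Measure (Space d)) : ℝ≥0∞ :=
  ⨅ γ ∈ couplings μ ν, (∫⁻ z, (edist z.1 z.2) ^ p ∂γ) ^ (1 / p)

/-- The uniform-weight discrete measure `(1/N) ∑ i, δ_{x i}`. -/
def empirical {d N : ℕ} (x : Fin N → Space d) : Measure (Space d) :=
  (N : ℝ≥0∞)⁻¹ • ∑ i, Measure.dirac (x i)

/-- The best uniform-weight `N`-point approximation error `e_{N;d,p}(μ)`. -/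
def quantError {d : ℕ} (N : ℕ) (p : ℝ) (μ : Measure (Space d)) : ℝ≥0∞ :=
  ⨅ x : Fin N → Space d, wasserstein p μ (empirical x)

open Classical in
/-- The critical dimension `p q / (q - p)`, equal to `p` when `q = ∞`. -/
def criticalDim (p : ℝ) (q : ℝ≥0∞) : ℝ :=
  if q = ∞ then p else p * q.toReal / (q.toReal - p)

/-- The real number `1 / q`, equal to `0` when `q = ∞`. -/
def recip (q : ℝ≥0∞) : ℝ := (q⁻¹).toReal

end UniformQuantization

end

/-! Mass is transported greedily in units of `1/N`. In a small ball, the largest possible multiple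
of `1/N` is sent to the centre and less than `1/N` is left over. Covering a ball of radius `ρ` at
scale `ρ 2⁻ⁿ` leaves mass of order `2^(nd)/N`, which is treated again at scale `n - 1`, and so on up
to scale `0`, where a mass of order `1/N` remains (`exists_split_dyadic`). With the finest scale
adapted to `t = N · mass`, the cost is at most `ρ^p Ψ(t)/N` up to a constant, where `Ψ` is a power
`t^θ` with `θ ≥ 1 - p/d` and `θ > 0`, or for `d < p` a constant, or for `d = p` a logarithm.

For `q = ∞` one ball suffices. For finite `q`, space is cut into dyadic shells, each treated this
way; the leftovers of the shells and the mass beyond a cutoff radius go to the origin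
(`IsProfile.quantError_le`). With the cutoff near `R N^(1/q)`, the part sent to the origin costs
`N^(p/q-1)`. What remains is `N^(θ-1) ∑ 2^(jp) μ(shell j)^θ`, and the moment bound makes its terms
at most of order `2^(j(p-qθ))`. Outer shells dominate if `θ < p/q`, inner ones if `θ > p/q`; at `θ =
p/q` about `log N` shells share the sum, which produces the logarithm. Comparing `1 - p/d` with
`p/q` is comparing `d` with the critical dimension.

For the limit, the cutoff uses `εN` in place of `N`: the inner cost becomes small with `ε`, and for
fixed `ε` the tail of the `q`-th moment vanishes as `N → ∞`. -/

namespace UniformQuantization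

/-! ### Partial couplings with atoms of mass `1/N` -/

/-- `ν` admits a coupling of `p`-cost at most `c` with a sum of atoms of mass `1 / N`. -/
def AtomicCoupling {d : ℕ} (N : ℕ) (p : ℝ) (ν : Measure (Space d)) (c : ℝ≥0∞) : Prop :=
  ∃ (k : ℕ) (x : Fin k → Space d) (γ : Measure (Space d × Space d)),
    γ.map Prod.fst = ν ∧ γ.map Prod.snd = (N : ℝ≥0∞)⁻¹ • ∑ i, Measure.dirac (x i) ∧
      ∫⁻ z, (edist z.1 z.2) ^ p ∂γ ≤ c

namespace AtomicCoupling

variable {d N : ℕ} {p : ℝ} {ν ν' : Measure (Space d)} {c c' : ℝ≥0∞}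

theorem mono (h : AtomicCoupling N p ν c) (hc : c ≤ c') : AtomicCoupling N p ν c' := by
  obtain ⟨k, x, γ, h1, h2, h3⟩ := h
  exact ⟨k, x, γ, h1, h2, h3.trans hc⟩

theorem zero : AtomicCoupling N p (0 : Measure (Space d)) 0 :=
  ⟨0, Fin.elim0, 0, by simp, by simp, by simp⟩

theorem add (h : AtomicCoupling N p ν c) (h' : AtomicCoupling N p ν' c') :
    AtomicCoupling N p (ν + ν') (c + c') := by
  obtain ⟨k, x, γ, h1, h2, h3⟩ := h
  obtain ⟨k', x', γ', h1', h2', h3'⟩ := h'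
  refine ⟨k + k', Fin.append x x', γ + γ', ?_, ?_, ?_⟩
  · rw [Measure.map_add _ _ measurable_fst, h1, h1']
  · rw [Measure.map_add _ _ measurable_snd, h2, h2', Fin.sum_univ_add]
    simp [smul_add]
  · rw [lintegral_add_measure]
    exact add_le_add h3 h3'

theorem measure_univ (h : AtomicCoupling N p ν c) : ∃ k : ℕ, ν Set.univ = k * (N : ℝ≥0∞)⁻¹ := by
  obtain ⟨k, x, γ, h1, h2, -⟩ := h
  refine ⟨k, ?_⟩
  have h3 : ν Set.univ = γ.map Prod.snd Set.univ := by
    rw [← h1, Measure.map_apply measurable_fst .univ, Measure.map_apply measurable_snd .univ]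
    simp
  rw [h3, h2]
  simp [mul_comm]

theorem of_measure_univ {k : ℕ} (h : ν Set.univ = k * (N : ℝ≥0∞)⁻¹) (y : Space d) :
    AtomicCoupling N p ν (∫⁻ x, edist x y ^ p ∂ν) := by
  refine ⟨k, fun _ => y, ν.map (fun x => (x, y)), ?_, ?_, ?_⟩
  · rw [Measure.map_map measurable_fst (by fun_prop)]
    exact Measure.map_id
  · rw [Measure.map_map measurable_snd (by fun_prop)]
    have : (Prod.snd ∘ fun x : Space d => (x, y)) = fun _ => y := rfl
    rw [this, Measure.map_const, h]
    ext s hs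
    simp [mul_comm, mul_assoc]
  · rw [lintegral_map (by fun_prop) (by fun_prop)]

/-- The number of atoms is left free in `AtomicCoupling`, so that pieces can be added. For a
probability measure, equality of total masses forces it to be `N`. -/
theorem quantError_le {μ : Measure (Space d)} [IsProbabilityMeasure μ] (hN : 1 ≤ N) (hp : 0 < p)
    (h : AtomicCoupling N p μ c) : quantError N p μ ≤ c ^ (1 / p) := by
  obtain ⟨k, x, γ, h1, h2, h3⟩ := h
  have hmass : (1 : ℝ≥0∞) = k * (N : ℝ≥0∞)⁻¹ := by
    have h4 : μ Set.univ = γ.map Prod.snd Set.univ := by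
      rw [← h1, Measure.map_apply measurable_fst .univ, Measure.map_apply measurable_snd .univ]
      simp
    rw [h2, MeasureTheory.measure_univ] at h4
    simpa [mul_comm] using h4
  have hN0 : (N : ℝ≥0∞) ≠ 0 := by simp; lia
  have hk : k = N := by
    have : (N : ℝ≥0∞) = k := by
      calc (N : ℝ≥0∞) = 1 * N := by simp
        _ = k := by rw [hmass, mul_assoc, ENNReal.inv_mul_cancel hN0 (by simp), mul_one]
    exact_mod_cast this.symm
  subst hk
  refine (iInf_le _ x).trans ((iInf₂_le γ ⟨h1, h2⟩).trans ?_)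
  exact ENNReal.rpow_le_rpow h3 (by positivity)

end AtomicCoupling

/-! ### Greedy atomization of a ball through dyadic scales -/

theorem exists_split_of_closedBall {d N : ℕ} {p : ℝ} (hp : 0 < p) (hN : 1 ≤ N)
    (ν : Measure (Space d)) [IsFiniteMeasure ν] (y : Space d) {δ : ℝ}
    (hν : ν (Metric.closedBall y δ)ᶜ = 0) :
    ∃ ν' l : Measure (Space d), ν = ν' + l ∧
      AtomicCoupling N p ν' (ENNReal.ofReal δ ^ p * ν' Set.univ) ∧
      l Set.univ ≤ (N : ℝ≥0∞)⁻¹ := by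
  have hN0 : (N : ℝ≥0∞) ≠ 0 := by simp; lia
  have hNt : (N : ℝ≥0∞) ≠ ∞ := by simp
  by_cases hm : ν Set.univ = 0
  · refine ⟨0, ν, by simp, by simpa using AtomicCoupling.zero, by simp [hm]⟩
  have hmt : ν Set.univ ≠ ∞ := measure_ne_top _ _
  set m := ν Set.univ with hmdef
  set k : ℕ := ⌊(N * m).toReal⌋₊ with hk
  have hNm : ENNReal.ofReal ((N * m).toReal) = N * m :=
    ENNReal.ofReal_toReal (ENNReal.mul_ne_top hNt hmt)
  have hk1 : (k : ℝ≥0∞) ≤ N * m := by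
    rw [← hNm, ← ENNReal.ofReal_natCast]
    exact ENNReal.ofReal_le_ofReal (Nat.floor_le ENNReal.toReal_nonneg)
  have hk2 : N * m ≤ k + 1 := by
    rw [← hNm]
    have : (k : ℝ≥0∞) + 1 = ENNReal.ofReal ((k : ℝ) + 1) := by
      rw [ENNReal.ofReal_add (by positivity) (by positivity)]; simp
    rw [this]
    exact ENNReal.ofReal_le_ofReal (Nat.lt_floor_add_one _).le
  have hNm0 : N * m ≠ 0 := mul_ne_zero hN0 hm
  have hNmt : N * m ≠ ∞ := ENNReal.mul_ne_top hNt hmt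
  -- Keeping the fraction `a` of `ν` leaves mass exactly `⌊N m⌋ / N`; the discarded fraction weighs
  -- at most `1/N`.
  set a : ℝ≥0∞ := k / (N * m) with ha
  have ha1 : a ≤ 1 := ENNReal.div_le_of_le_mul (by simpa using hk1)
  have ham : a * m = k * (N : ℝ≥0∞)⁻¹ := by
    rw [ha, div_eq_mul_inv, ENNReal.mul_inv (Or.inl hN0) (Or.inl hNt), mul_assoc, mul_assoc,
      ENNReal.inv_mul_cancel hm hmt, mul_one]
  have hmass : (a • ν) Set.univ = k * (N : ℝ≥0∞)⁻¹ := by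
    rw [Measure.smul_apply, smul_eq_mul, ← hmdef, ham]
  refine ⟨a • ν, (1 - a) • ν, ?_, ?_, ?_⟩
  · rw [← add_smul, add_tsub_cancel_of_le ha1, one_smul]
  · refine (AtomicCoupling.of_measure_univ hmass y).mono ?_
    rw [← lintegral_const]
    refine lintegral_mono_ae ?_
    have h0 : (a • ν) (Metric.closedBall y δ)ᶜ = 0 := by simp [hν]
    filter_upwards [compl_mem_ae_iff.2 h0] with x hx
    rw [compl_compl, Metric.mem_closedBall] at hx
    refine ENNReal.rpow_le_rpow ?_ hp.le
    rw [edist_dist]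
    exact ENNReal.ofReal_le_ofReal hx
  · rw [Measure.smul_apply, smul_eq_mul, ← hmdef]
    have h5 : (1 - a) * m = m - k * (N : ℝ≥0∞)⁻¹ := by
      rw [ENNReal.sub_mul (fun _ _ => hmt), one_mul, ham]
    rw [h5, tsub_le_iff_left]
    calc m = (N * m) * (N : ℝ≥0∞)⁻¹ := by
          rw [mul_comm (N : ℝ≥0∞), mul_assoc, ENNReal.mul_inv_cancel hN0 hNt, mul_one]
      _ ≤ (k + 1) * (N : ℝ≥0∞)⁻¹ := by gcongr
      _ = _ := by rw [add_mul, one_mul]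

/-- The balls may overlap, so they are treated one at a time, each restricted to the complement of
those already used; each contributes at most `1/N` of leftover. -/
theorem exists_split_of_cover {d N : ℕ} {p : ℝ} (hp : 0 < p) (hN : 1 ≤ N) {ι : Type*}
    (y : ι → Space d) (δ : ℝ) (s : Finset ι) :
    ∀ (ν : Measure (Space d)) [IsFiniteMeasure ν],
      ν (⋃ i ∈ s, Metric.closedBall (y i) δ)ᶜ = 0 →
    ∃ ν' l : Measure (Space d), ν = ν' + l ∧
      AtomicCoupling N p ν' (ENNReal.ofReal δ ^ p * ν' Set.univ) ∧
      l Set.univ ≤ s.card * (N : ℝ≥0∞)⁻¹ := by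
  classical
  induction s using Finset.induction_on with
  | empty =>
    intro ν _ hν
    have : ν = 0 := by simpa using hν
    exact ⟨0, 0, by simp [this], by simpa using AtomicCoupling.zero, by simp⟩
  | insert i s hi ih =>
    intro ν _ hν
    set B := Metric.closedBall (y i) δ
    have hB : MeasurableSet B := measurableSet_closedBall
    obtain ⟨ν₁, l₁, e₁, c₁, b₁⟩ := exists_split_of_closedBall hp hN (ν.restrict B) (y i) (δ := δ)
      (by rw [Measure.restrict_apply hB.compl]; simp [B])
    obtain ⟨ν₂, l₂, e₂, c₂, b₂⟩ := ih (ν.restrict Bᶜ) (by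
      rw [Measure.restrict_apply
        (Finset.measurableSet_biUnion _ fun _ _ => measurableSet_closedBall).compl]
      refine measure_mono_null ?_ hν
      intro x hx
      simp only [Finset.mem_insert, Set.iUnion_iUnion_eq_or_left, Set.compl_union]
      exact ⟨hx.2, hx.1⟩)
    refine ⟨ν₁ + ν₂, l₁ + l₂, ?_, ?_, ?_⟩
    · rw [← Measure.restrict_add_restrict_compl (μ := ν) hB, e₁, e₂]
      abel
    · convert c₁.add c₂ using 1
      rw [Measure.add_apply, mul_add]
    · rw [Measure.add_apply, Finset.card_insert_of_notMem hi]
      push_cast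
      rw [add_mul, one_mul, add_comm]
      gcongr

/-- A closed ball of radius `ρ` is covered by `(3 · 2 ^ n) ^ d` balls of radius `√d · ρ · 2⁻ⁿ`. -/
theorem exists_finset_cover_closedBall (d : ℕ) {ρ : ℝ} (hρ : 0 < ρ) (n : ℕ) :
    ∃ s : Finset (Space d), s.card ≤ (3 * 2 ^ n) ^ d ∧
      Metric.closedBall (0 : Space d) ρ ⊆
        ⋃ y ∈ s, Metric.closedBall y (√d * (ρ / 2 ^ n)) := by
  classical
  set δ := ρ / 2 ^ n with hδ
  have hδ0 : 0 < δ := by positivity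
  let g : (Fin d → ℤ) → Space d := fun z => WithLp.toLp 2 (fun i => δ * (z i : ℝ))
  -- Rounding each coordinate down to `δℤ` moves it by at most `δ`; each axis carries `2 · 2ⁿ + 1 ≤
  -- 3 · 2ⁿ` grid values.
  refine ⟨(Fintype.piFinset fun _ : Fin d => Finset.Icc (-2 ^ n : ℤ) (2 ^ n)).image g, ?_, ?_⟩
  · refine Finset.card_image_le.trans ?_
    rw [Fintype.card_piFinset]
    simp only [Int.card_Icc, Finset.prod_const, Finset.card_univ, Fintype.card_fin]
    refine Nat.pow_le_pow_left ?_ d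
    have : (1 : ℤ) ≤ 2 ^ n := one_le_pow₀ (by norm_num)
    zify
    rw [Int.toNat_of_nonneg (by linarith)]
    linarith
  · intro x hx
    rw [mem_closedBall_zero_iff] at hx
    simp only [Set.mem_iUnion, exists_prop]
    refine ⟨g fun i => ⌊x i / δ⌋, Finset.mem_image_of_mem _ ?_, ?_⟩
    · rw [Fintype.mem_piFinset]
      intro i
      have hxi : |x i| ≤ ρ := (PiLp.norm_apply_le x i).trans hx
      rw [abs_le] at hxi
      have hρδ : ρ = δ * 2 ^ n := by rw [hδ]; field_simp
      rw [Finset.mem_Icc]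
      constructor
      · rw [Int.le_floor, le_div_iff₀ hδ0]
        push_cast
        nlinarith [hxi.1]
      · have h1 : x i / δ ≤ 2 ^ n := by
          rw [div_le_iff₀ hδ0]; linarith [hxi.2]
        have h2 := (Int.floor_le (x i / δ)).trans h1
        exact (Int.cast_le (R := ℝ)).1 (by push_cast; exact h2)
    · rw [Metric.mem_closedBall, EuclideanSpace.dist_eq]
      have hδs : √d * δ = √(d * δ ^ 2) := by
        rw [Real.sqrt_mul (by positivity), Real.sqrt_sq hδ0.le]
      rw [hδs]
      refine Real.sqrt_le_sqrt ?_
      calc ∑ i, dist (x i) (g (fun i => ⌊x i / δ⌋) i) ^ 2 ≤ ∑ _i : Fin d, δ ^ 2 := by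
            refine Finset.sum_le_sum fun i _ => ?_
            refine pow_le_pow_left₀ dist_nonneg ?_ 2
            have h1 := Int.floor_le (x i / δ)
            have h2 := Int.lt_floor_add_one (x i / δ)
            rw [le_div_iff₀ hδ0] at h1
            rw [div_lt_iff₀ hδ0] at h2
            change |x i - δ * (⌊x i / δ⌋ : ℝ)| ≤ δ
            rw [abs_le]
            constructor <;> linarith
        _ = d * δ ^ 2 := by simp

/-- Cost of atomizing a measure of mass `m`, multiplied by `N`, on a ball of radius one
through the dyadic scales `n, n - 1, …, 0`; here `t = N m`. -/
noncomputable def dyadicCost (d : ℕ) (p : ℝ) (n : ℕ) (t : ℝ) : ℝ :=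
  ((2 : ℝ) ^ n)⁻¹ ^ p * t + 3 ^ d * ∑ k ∈ Finset.range n, ((2 : ℝ) ^ k)⁻¹ ^ p * 2 ^ ((k + 1) * d)

theorem dyadicCost_mono {d : ℕ} {p : ℝ} {n : ℕ} {t t' : ℝ} (h : t ≤ t') :
    dyadicCost d p n t ≤ dyadicCost d p n t' := by
  unfold dyadicCost; gcongr

theorem dyadicCost_nonneg {d : ℕ} {p : ℝ} {n : ℕ} {t : ℝ} (h : 0 ≤ t) :
    0 ≤ dyadicCost d p n t := by
  unfold dyadicCost; positivity

/-- Each scale consumes the leftover of the next finer one. The mass of `ν` itself is paid for only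
at the finest scale; every coarser scale receives a mass bounded by the size of the previous cover
over `N`. -/
theorem exists_split_dyadic {d N : ℕ} {p : ℝ} (hp : 0 < p) (hN : 1 ≤ N) {ρ : ℝ} (hρ : 0 < ρ)
    (n : ℕ) : ∀ (ν : Measure (Space d)) [IsFiniteMeasure ν],
      ν (Metric.closedBall 0 ρ)ᶜ = 0 →
    ∃ ν' l : Measure (Space d), ν = ν' + l ∧
      AtomicCoupling N p ν' (ENNReal.ofReal
        (√d ^ p * ρ ^ p * dyadicCost d p n (N * ν.real Set.univ) / N)) ∧
      l Set.univ ≤ 3 ^ d * (N : ℝ≥0∞)⁻¹ := by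
  have hN0 : (0 : ℝ) < N := by exact_mod_cast hN
  have key : ∀ (n : ℕ) (ν : Measure (Space d)) [IsFiniteMeasure ν],
      ν (Metric.closedBall 0 ρ)ᶜ = 0 → ∃ ν' l : Measure (Space d), ν = ν' + l ∧
      AtomicCoupling N p ν' (ENNReal.ofReal
        (√d ^ p * ρ ^ p * (((2 : ℝ) ^ n)⁻¹ ^ p * ν.real Set.univ))) ∧
      l.real Set.univ ≤ 3 ^ d * 2 ^ (n * d) / N := by
    intro n ν _ hν
    obtain ⟨s, hs, hcov⟩ := exists_finset_cover_closedBall d hρ n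
    obtain ⟨ν', l, e, c, b⟩ := exists_split_of_cover hp hN (fun y => y) (√d * (ρ / 2 ^ n)) s ν
      (measure_mono_null (Set.compl_subset_compl.2 hcov) hν)
    refine ⟨ν', l, e, c.mono ?_, ?_⟩
    · have h1 : ν' Set.univ ≤ ν Set.univ := by rw [e]; simp
      rw [ENNReal.ofReal_rpow_of_nonneg (by positivity) hp.le]
      calc ENNReal.ofReal ((√d * (ρ / 2 ^ n)) ^ p) * ν' Set.univ
          ≤ ENNReal.ofReal ((√d * (ρ / 2 ^ n)) ^ p) * ENNReal.ofReal (ν.real Set.univ) := by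
            rw [ofReal_measureReal]; gcongr
        _ = ENNReal.ofReal ((√d * (ρ / 2 ^ n)) ^ p * ν.real Set.univ) := by
            rw [ENNReal.ofReal_mul (by positivity)]
        _ ≤ _ := by
            refine ENNReal.ofReal_le_ofReal ?_
            rw [div_eq_mul_inv, Real.mul_rpow (by positivity) (by positivity),
              Real.mul_rpow (by positivity) (by positivity)]
            exact le_of_eq (by ring)
    · refine ENNReal.toReal_le_of_le_ofReal (by positivity) (b.trans ?_)
      rw [div_eq_mul_inv, ENNReal.ofReal_mul (by positivity), ENNReal.ofReal_inv_of_pos hN0,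
        ENNReal.ofReal_natCast]
      gcongr
      rw [← ENNReal.ofReal_natCast]
      refine ENNReal.ofReal_le_ofReal ?_
      calc (s.card : ℝ) ≤ ((3 * 2 ^ n) ^ d : ℕ) := by exact_mod_cast hs
        _ = _ := by push_cast; rw [mul_pow, pow_mul]
  induction n with
  | zero =>
    intro ν _ hν
    obtain ⟨ν', l, e, c, b⟩ := key 0 ν hν
    refine ⟨ν', l, e, c.mono (ENNReal.ofReal_le_ofReal (le_of_eq ?_)), ?_⟩
    · unfold dyadicCost; simp; field_simp
    · have : IsFiniteMeasure l := isFiniteMeasure_of_le ν (by rw [e]; exact Measure.le_add_left le_rfl)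
      rw [← ofReal_measureReal]
      refine (ENNReal.ofReal_le_ofReal b).trans (le_of_eq ?_)
      rw [div_eq_mul_inv, ENNReal.ofReal_mul (by positivity), ENNReal.ofReal_inv_of_pos hN0,
        ENNReal.ofReal_natCast]
      simp
  | succ n ih =>
    intro ν _ hν
    obtain ⟨ν₁, l₁, e₁, c₁, b₁⟩ := key (n + 1) ν hν
    have hle : l₁ ≤ ν := by rw [e₁]; exact Measure.le_add_left le_rfl
    have : IsFiniteMeasure l₁ := isFiniteMeasure_of_le ν hle
    obtain ⟨ν₂, l₂, e₂, c₂, b₂⟩ := ih l₁ (le_antisymm ((hle _).trans hν.le) (zero_le))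
    refine ⟨ν₁ + ν₂, l₂, by rw [e₁, e₂, add_assoc], (c₁.add c₂).mono ?_, b₂⟩
    rw [← ENNReal.ofReal_add (by positivity)
      (div_nonneg (mul_nonneg (by positivity) (dyadicCost_nonneg (by positivity))) hN0.le)]
    refine ENNReal.ofReal_le_ofReal ?_
    -- The bound on the leftover no longer depends on `ν`; inserted as the mass at scale `n`, it
    -- yields the new last term of the sum in `dyadicCost`.
    have hb : dyadicCost d p n (N * l₁.real Set.univ) ≤
        dyadicCost d p n (3 ^ d * 2 ^ ((n + 1) * d)) :=
      dyadicCost_mono (by rwa [le_div_iff₀' hN0] at b₁)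
    calc _ ≤ √d ^ p * ρ ^ p * (((2 : ℝ) ^ (n + 1))⁻¹ ^ p * ν.real Set.univ) +
          √d ^ p * ρ ^ p * dyadicCost d p n (3 ^ d * 2 ^ ((n + 1) * d)) / N := by gcongr
      _ = _ := by
        unfold dyadicCost
        rw [Finset.sum_range_succ]
        field_simp
        ring

/-- `Ψ` bounds the dyadic atomization cost for a suitable choice of the finest scale. -/
def IsProfile (d : ℕ) (p : ℝ) (Ψ : ℝ → ℝ) : Prop :=
  (∀ t, 0 ≤ t → 0 ≤ Ψ t) ∧ ∀ t, 1 ≤ t → ∃ n, dyadicCost d p n t ≤ Ψ t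

theorem IsProfile.exists_split {d N : ℕ} {p : ℝ} {Ψ : ℝ → ℝ} (hΨ : IsProfile d p Ψ)
    (hp : 0 < p) (hN : 1 ≤ N) {ρ : ℝ} (hρ : 0 < ρ) (ν : Measure (Space d)) [IsFiniteMeasure ν]
    (hν : ν (Metric.closedBall 0 ρ)ᶜ = 0) :
    ∃ ν' l : Measure (Space d), ν = ν' + l ∧
      AtomicCoupling N p ν' (ENNReal.ofReal
        (√d ^ p * ρ ^ p * Ψ (N * ν.real Set.univ) / N)) ∧
      l Set.univ ≤ 3 ^ d * (N : ℝ≥0∞)⁻¹ := by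
  have hN0 : (0 : ℝ) < N := by exact_mod_cast hN
  by_cases ht : 1 ≤ N * ν.real Set.univ
  · obtain ⟨n, hn⟩ := hΨ.2 _ ht
    obtain ⟨ν', l, e, c, b⟩ := exists_split_dyadic hp hN hρ n ν hν
    refine ⟨ν', l, e, c.mono (ENNReal.ofReal_le_ofReal ?_), b⟩
    gcongr
  -- A mass below `1/N` is left over entirely, which is why a profile is only constrained for `t ≥
  -- 1`.
  · refine ⟨0, ν, by simp, AtomicCoupling.zero.mono (zero_le), ?_⟩
    push Not at ht
    have h1 : ν Set.univ ≤ (N : ℝ≥0∞)⁻¹ := by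
      rw [← ofReal_measureReal, ← ENNReal.ofReal_natCast, ← ENNReal.ofReal_inv_of_pos hN0]
      refine ENNReal.ofReal_le_ofReal ?_
      rw [← one_div, le_div_iff₀' hN0]
      exact ht.le
    refine h1.trans (le_mul_of_one_le_left (zero_le) ?_)
    exact one_le_pow₀ (by norm_num)

/-! ### Decomposition into shells -/

/-- The dyadic shells of `ℝ^d` with base radius `R`. -/
def shell (d : ℕ) (R : ℝ) : ℕ → Set (Space d)
  | 0 => Metric.closedBall 0 R
  | j + 1 => Metric.closedBall 0 (R * 2 ^ (j + 1)) \ Metric.closedBall 0 (R * 2 ^ j)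

theorem measurableSet_shell (d : ℕ) (R : ℝ) (j : ℕ) : MeasurableSet (shell d R j) := by
  cases j with
  | zero => exact measurableSet_closedBall
  | succ j => exact measurableSet_closedBall.diff measurableSet_closedBall

theorem shell_subset (d : ℕ) (R : ℝ) (j : ℕ) :
    shell d R j ⊆ Metric.closedBall 0 (R * 2 ^ j) := by
  cases j with
  | zero => simp [shell]
  | succ j => exact Set.sdiff_subset

theorem restrict_closedBall_eq_sum_shell {d : ℕ} (μ : Measure (Space d)) {R : ℝ} (hR : 0 < R)
    (J : ℕ) : μ.restrict (Metric.closedBall 0 (R * 2 ^ J)) =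
      ∑ j ∈ Finset.range (J + 1), μ.restrict (shell d R j) := by
  induction J with
  | zero => simp [shell]
  | succ J ih =>
    rw [Finset.sum_range_succ, ← ih, shell]
    have h : Metric.closedBall (0 : Space d) (R * 2 ^ J) ⊆
        Metric.closedBall 0 (R * 2 ^ (J + 1)) := by
      refine Metric.closedBall_subset_closedBall ?_
      gcongr <;> norm_num
    rw [← Measure.restrict_union Set.disjoint_sdiff_right
      (measurableSet_closedBall.diff measurableSet_closedBall), Set.union_sdiff_cancel h]

theorem lintegral_edist_zero_le {d : ℕ} {p ρ : ℝ} (hp : 0 < p) {l : Measure (Space d)}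
    (hl : l (Metric.closedBall 0 ρ)ᶜ = 0) :
    ∫⁻ x, edist x 0 ^ p ∂l ≤ ENNReal.ofReal ρ ^ p * l Set.univ := by
  rw [← lintegral_const]
  refine lintegral_mono_ae ?_
  filter_upwards [compl_mem_ae_iff.2 hl] with x hx
  rw [compl_compl, Metric.mem_closedBall] at hx
  refine ENNReal.rpow_le_rpow ?_ hp.le
  rw [edist_dist]
  exact ENNReal.ofReal_le_ofReal hx

/-- The leftovers are recorded through their cost of transport to the origin, their final
destination, so only a weighted sum of the bounds `3^d / N` is needed. -/
theorem IsProfile.exists_split_shells {d N : ℕ} {p : ℝ} {Ψ : ℝ → ℝ} (hΨ : IsProfile d p Ψ)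
    (hp : 0 < p) (hN : 1 ≤ N) {R : ℝ} (hR : 0 < R) (μ : Measure (Space d)) [IsFiniteMeasure μ]
    (J : ℕ) : ∃ ν' l : Measure (Space d),
      ∑ j ∈ Finset.range J, μ.restrict (shell d R j) = ν' + l ∧
      AtomicCoupling N p ν' (ENNReal.ofReal (∑ j ∈ Finset.range J,
        √d ^ p * (R * 2 ^ j) ^ p * Ψ (N * μ.real (shell d R j)) / N)) ∧
      ∫⁻ x, edist x 0 ^ p ∂l ≤
        ENNReal.ofReal (∑ j ∈ Finset.range J, 3 ^ d * (R * 2 ^ j) ^ p / N) := by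
  have hN0 : (0 : ℝ) < N := by exact_mod_cast hN
  have hnn : ∀ j, 0 ≤ √d ^ p * (R * 2 ^ j) ^ p * Ψ (N * μ.real (shell d R j)) / N := fun j =>
    div_nonneg (mul_nonneg (by positivity) (hΨ.1 _ (by positivity))) hN0.le
  induction J with
  | zero => exact ⟨0, 0, by simp, by simpa using AtomicCoupling.zero, by simp⟩
  | succ J ih =>
    obtain ⟨ν₁, l₁, e₁, c₁, b₁⟩ := ih
    have hsupp : μ.restrict (shell d R J) (Metric.closedBall 0 (R * 2 ^ J))ᶜ = 0 := by
      rw [Measure.restrict_apply measurableSet_closedBall.compl]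
      convert measure_empty (μ := μ)
      rw [← Set.disjoint_iff_inter_eq_empty, Set.disjoint_compl_left_iff_subset]
      exact shell_subset d R J
    obtain ⟨ν₂, l₂, e₂, c₂, b₂⟩ := hΨ.exists_split hp hN (ρ := R * 2 ^ J) (by positivity) _ hsupp
    refine ⟨ν₁ + ν₂, l₁ + l₂, ?_, ?_, ?_⟩
    · rw [Finset.sum_range_succ, e₁, e₂]; abel
    · convert c₁.add c₂ using 1
      rw [Finset.sum_range_succ, ENNReal.ofReal_add (Finset.sum_nonneg fun j _ => hnn j) (hnn J),
        measureReal_restrict_apply_univ]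
    · rw [Finset.sum_range_succ, ENNReal.ofReal_add (by positivity) (by positivity),
        lintegral_add_measure]
      refine add_le_add b₁ ((lintegral_edist_zero_le hp (ρ := R * 2 ^ J) ?_).trans ?_)
      · refine le_antisymm (le_trans ?_ hsupp.le) (zero_le)
        rw [e₂]; simp
      · rw [ENNReal.ofReal_rpow_of_nonneg (by positivity) hp.le]
        refine (mul_le_mul_right b₂ _).trans (le_of_eq ?_)
        rw [div_eq_mul_inv, ENNReal.ofReal_mul (by positivity), ENNReal.ofReal_mul (by positivity),
          ENNReal.ofReal_inv_of_pos hN0, ENNReal.ofReal_natCast, ENNReal.ofReal_pow (by norm_num),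
          ENNReal.ofReal_ofNat]
        ring

/-- The part of the moment of order `q` carried by the complement of a ball. -/
noncomputable def tailMoment {d : ℕ} (q : ℝ) (μ : Measure (Space d)) (T : ℝ) : ℝ≥0∞ :=
  ∫⁻ x in (Metric.closedBall 0 T)ᶜ, ‖x‖ₑ ^ q ∂μ

theorem IsProfile.quantError_le {d N : ℕ} {p : ℝ} {Ψ : ℝ → ℝ} (hΨ : IsProfile d p Ψ)
    (hp : 0 < p) (hN : 1 ≤ N) {R : ℝ} (hR : 0 < R) (μ : Measure (Space d))
    [IsProbabilityMeasure μ] (J : ℕ) :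
    quantError N p μ ≤ (ENNReal.ofReal ((√d ^ p + 3 ^ d) * R ^ p *
      ((∑ j ∈ Finset.range (J + 1), ((2 : ℝ) ^ j) ^ p * (1 + Ψ (N * μ.real (shell d R j)))) / N)) +
        tailMoment p μ (R * 2 ^ J)) ^ (1 / p) := by
  have hN0 : (0 : ℝ) < N := by exact_mod_cast hN
  have hN0' : (N : ℝ≥0∞) ≠ 0 := by simp; lia
  obtain ⟨ν', l, e, c, b⟩ := hΨ.exists_split_shells hp hN hR μ (J + 1)
  rw [← restrict_closedBall_eq_sum_shell μ hR] at e
  set B := Metric.closedBall (0 : Space d) (R * 2 ^ J) with hB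
  set L := l + μ.restrict Bᶜ with hL
  have hμ : μ = ν' + L := by
    rw [hL, ← add_assoc, ← e, Measure.restrict_add_restrict_compl measurableSet_closedBall]
  obtain ⟨k, hk⟩ := c.measure_univ
  have hmass : ν' Set.univ + L Set.univ = 1 := by
    rw [← Measure.add_apply, ← hμ, measure_univ]
  have hνt : ν' Set.univ ≠ ∞ := by
    intro h; rw [h] at hmass; simp at hmass
  -- What is not yet atomized automatically has mass a multiple of `1/N`, being the complement to
  -- `1` of such a multiple, so it can all be sent to the origin. Subtraction is truncated on both
  -- sides, hence `k ≤ N` need not be checked.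
  have hLmass : L Set.univ = (N - k : ℕ) * (N : ℝ≥0∞)⁻¹ := by
    have h1 : L Set.univ = 1 - ν' Set.univ := by
      rw [← hmass, ENNReal.add_sub_cancel_left hνt]
    rw [h1, hk, ENNReal.natCast_sub, ENNReal.sub_mul (fun _ _ => ENNReal.inv_ne_top.2 hN0'),
      ENNReal.mul_inv_cancel hN0' (by simp)]
  have hc := c.add (AtomicCoupling.of_measure_univ (p := p) hLmass 0)
  rw [← hμ] at hc
  refine (AtomicCoupling.quantError_le hN hp hc).trans (ENNReal.rpow_le_rpow ?_ (by positivity))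
  have hnn : ∀ j, 0 ≤ √d ^ p * (R * 2 ^ j) ^ p * Ψ (N * μ.real (shell d R j)) / N := fun j =>
    div_nonneg (mul_nonneg (by positivity) (hΨ.1 _ (by positivity))) hN0.le
  have htail : ∫⁻ x in Bᶜ, edist x 0 ^ p ∂μ = tailMoment p μ (R * 2 ^ J) := by
    simp [tailMoment, hB, edist_zero_right]
  rw [hL, lintegral_add_measure, htail, ← add_assoc]
  gcongr
  refine (add_le_add le_rfl b).trans ?_
  rw [← ENNReal.ofReal_add (Finset.sum_nonneg fun j _ => hnn j) (Finset.sum_nonneg fun _ _ => by positivity)]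
  refine ENNReal.ofReal_le_ofReal ?_
  rw [← Finset.sum_add_distrib, Finset.sum_div, Finset.mul_sum]
  refine Finset.sum_le_sum fun j _ => ?_
  rw [Real.mul_rpow hR.le (by positivity), ← add_div, ← mul_div_assoc]
  gcongr
  have h1 := hΨ.1 (N * μ.real (shell d R j)) (by positivity)
  have h2 : 0 ≤ R ^ p * (2 ^ j) ^ p := by positivity
  have h3 : 0 ≤ √d ^ p * (R ^ p * (2 ^ j) ^ p) := by positivity
  have h4 : 0 ≤ 3 ^ d * (R ^ p * ((2 : ℝ) ^ j) ^ p) * Ψ (N * μ.real (shell d R j)) := by positivity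
  linarith

/-! ### Profiles: optimizing the finest scale -/

theorem two_pow_rpow (n : ℕ) (a : ℝ) : ((2 : ℝ) ^ n) ^ a = ((2 : ℝ) ^ a) ^ n := by
  rw [← Real.rpow_natCast, ← Real.rpow_natCast, ← Real.rpow_mul (by norm_num),
    ← Real.rpow_mul (by norm_num), mul_comm]

theorem geom_sum_range_le {r : ℝ} (hr : 1 < r) (n : ℕ) :
    ∑ k ∈ Finset.range n, r ^ k ≤ r ^ n / (r - 1) := by
  rw [geom_sum_eq hr.ne']
  have : 0 < r - 1 := by linarith
  gcongr; linarith

theorem geom_sum_range_le_of_lt_one {r : ℝ} (hr0 : 0 ≤ r) (hr : r < 1) (n : ℕ) :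
    ∑ k ∈ Finset.range n, r ^ k ≤ 1 / (1 - r) := by
  rw [geom_sum_eq hr.ne, ← neg_div_neg_eq, neg_sub, neg_sub]
  have : 0 < 1 - r := by linarith
  have := pow_nonneg hr0 n
  gcongr; linarith

theorem dyadicCost_term {d : ℕ} {p : ℝ} (k : ℕ) :
    ((2 : ℝ) ^ k)⁻¹ ^ p * 2 ^ ((k + 1) * d) = 2 ^ d * ((2 : ℝ) ^ ((d : ℝ) - p)) ^ k := by
  rw [Real.inv_rpow (by positivity), two_pow_rpow, Real.rpow_sub (by norm_num), div_pow, add_mul,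
    pow_add, one_mul, Real.rpow_natCast, mul_comm k d, pow_mul]
  field_simp

/-- The finest scale adapted to `t`. -/
theorem exists_scale {d : ℕ} (hd : 1 ≤ d) {p : ℝ} (hp : 0 < p) {t : ℝ} (ht : 1 ≤ t) :
    ∃ n : ℕ, ((2 : ℝ) ^ n) ^ d ≤ t ∧
      ((2 : ℝ) ^ n)⁻¹ ^ p * t ≤ 2 ^ p * t ^ (1 - p / d) := by
  have hd0 : (0 : ℝ) < d := by exact_mod_cast hd
  obtain ⟨n, h1, h2⟩ := exists_nat_pow_near ht (y := (2 : ℝ) ^ d)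
    (one_lt_pow₀ (by norm_num) (by lia))
  refine ⟨n, by rwa [← pow_mul, mul_comm, pow_mul], ?_⟩
  have ht0 : 0 < t := by linarith
  have h3 : t ^ (1 / (d : ℝ)) ≤ 2 ^ (n + 1) := by
    rw [one_div, Real.rpow_inv_le_iff_of_pos ht0.le (by positivity) hd0, Real.rpow_natCast,
      ← pow_mul, mul_comm, pow_mul]
    exact h2.le
  have h4 : t ^ (p / d) ≤ 2 ^ p * ((2 : ℝ) ^ n) ^ p := by
    rw [← Real.mul_rpow (by norm_num) (by positivity), ← pow_succ', div_eq_mul_inv, mul_comm,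
      ← one_div, Real.rpow_mul ht0.le]
    exact Real.rpow_le_rpow (by positivity) h3 hp.le
  rw [Real.inv_rpow (by positivity), Real.rpow_sub ht0, Real.rpow_one, inv_mul_le_iff₀
    (by positivity), mul_div_assoc', mul_div_assoc', le_div_iff₀ (by positivity)]
  calc t * t ^ (p / d) ≤ t * (2 ^ p * ((2 : ℝ) ^ n) ^ p) := by gcongr
    _ = _ := by ring

/-- The cost sum is geometric of ratio `2^(d-p)`, at most `r = 2^(dθ) > 1`, so the last term
dominates and is controlled by `(2^(nd))^θ ≤ t^θ`. The freedom in `θ` covers `d ≤ p` and is used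
again when shells are summed. -/
theorem isProfile_rpow {d : ℕ} (hd : 1 ≤ d) {p : ℝ} (hp : 0 < p) {θ : ℝ} (hθ : 0 < θ)
    (hθd : 1 - p / d ≤ θ) : ∃ K, 0 < K ∧ IsProfile d p fun t => K * t ^ θ := by
  have hd0 : (0 : ℝ) < d := by exact_mod_cast hd
  set r : ℝ := (2 : ℝ) ^ (d * θ) with hr
  have hr1 : 1 < r := Real.one_lt_rpow (by norm_num) (by positivity)
  have hr0 : 0 < r - 1 := by linarith
  refine ⟨2 ^ p + 3 ^ d * (2 ^ d / (r - 1)), by positivity, fun t ht => by positivity,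
    fun t ht => ?_⟩
  obtain ⟨n, h1, h2⟩ := exists_scale hd hp ht
  refine ⟨n, ?_⟩
  unfold dyadicCost
  beta_reduce
  rw [add_mul]
  refine add_le_add (h2.trans ?_) ?_
  · gcongr
  · rw [mul_assoc]
    gcongr
    simp only [dyadicCost_term]
    rw [← Finset.mul_sum, div_mul_eq_mul_div, mul_div_assoc]
    gcongr
    have h3 : (2 : ℝ) ^ ((d : ℝ) - p) ≤ r := by
      refine Real.rpow_le_rpow_of_exponent_le (by norm_num) ?_
      have : d * (1 - p / d) ≤ d * θ := by gcongr
      rwa [mul_sub, mul_one, mul_div_cancel₀ _ hd0.ne'] at this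
    calc ∑ k ∈ Finset.range n, ((2 : ℝ) ^ ((d : ℝ) - p)) ^ k
        ≤ ∑ k ∈ Finset.range n, r ^ k := by gcongr
      _ ≤ r ^ n / (r - 1) := geom_sum_range_le hr1 n
      _ ≤ _ := by
        gcongr
        rw [hr, Real.rpow_mul (by norm_num), Real.rpow_natCast, ← Real.rpow_natCast ((2 ^ d : ℝ) ^ θ), ← Real.rpow_mul (by positivity), mul_comm θ, Real.rpow_mul (by positivity), Real.rpow_natCast, ← pow_mul, mul_comm, pow_mul]
        exact Real.rpow_le_rpow (by positivity) h1 hθ.le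

/-- The ratio `2^(d-p)` is below `1`: the coarsest scales dominate, whatever the finest one. -/
theorem isProfile_const {d : ℕ} (hd : 1 ≤ d) {p : ℝ} (hdp : d < p) :
    ∃ K, 0 < K ∧ IsProfile d p fun _ => K := by
  have hd0 : (0 : ℝ) < d := by exact_mod_cast hd
  have hp : 0 < p := hd0.trans hdp
  set r : ℝ := (2 : ℝ) ^ ((d : ℝ) - p) with hr
  have hr0 : 0 ≤ r := by positivity
  have hr1 : r < 1 := Real.rpow_lt_one_of_one_lt_of_neg (by norm_num) (by linarith)
  have hr2 : 0 < 1 - r := by linarith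
  refine ⟨2 ^ p + 3 ^ d * (2 ^ d * (1 / (1 - r))), by positivity, fun t _ => by positivity,
    fun t ht => ?_⟩
  obtain ⟨n, h1, h2⟩ := exists_scale hd hp ht
  refine ⟨n, ?_⟩
  unfold dyadicCost
  refine add_le_add (h2.trans ?_) ?_
  · refine mul_le_of_le_one_right (by positivity) (Real.rpow_le_one_of_one_le_of_nonpos ht ?_)
    rw [sub_nonpos, one_le_div hd0]
    exact hdp.le
  · gcongr
    simp only [dyadicCost_term]
    rw [← Finset.mul_sum]
    gcongr
    exact geom_sum_range_le_of_lt_one hr0 hr1 n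

/-- The ratio is `1`, so all `n` scales cost the same, and `n` is at most of order `log t`. -/
theorem isProfile_log {d : ℕ} (hd : 1 ≤ d) {p : ℝ} (hdp : d = p) :
    ∃ K, 0 < K ∧ IsProfile d p fun t => K * Real.log (1 + t) := by
  have hd0 : (0 : ℝ) < d := by exact_mod_cast hd
  have hl2 : 0 < Real.log 2 := Real.log_pos (by norm_num)
  refine ⟨(2 ^ p + 3 ^ d * 2 ^ d) / Real.log 2, by positivity,
    fun t ht => mul_nonneg (by positivity) (Real.log_nonneg (by linarith)), fun t ht => ?_⟩
  obtain ⟨n, h1, h2⟩ := exists_scale hd (hdp ▸ hd0) ht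
  refine ⟨n, ?_⟩
  have h3 : Real.log 2 ≤ Real.log (1 + t) := Real.log_le_log (by norm_num) (by linarith)
  have h4 : n * Real.log 2 ≤ Real.log (1 + t) := by
    rw [← Real.log_pow]
    refine Real.log_le_log (by positivity) ?_
    have : (2 : ℝ) ^ n ≤ (2 ^ n) ^ d := le_self_pow₀ (one_le_pow₀ (by norm_num)) (by lia)
    linarith
  unfold dyadicCost
  simp only [dyadicCost_term]
  rw [← hdp, div_self hd0.ne', sub_self, Real.rpow_zero, mul_one] at h2
  simp only [← hdp, sub_self, Real.rpow_zero, one_pow, mul_one, Finset.sum_const,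
    Finset.card_range, nsmul_eq_mul]
  rw [div_mul_eq_mul_div, le_div_iff₀ hl2, add_mul, add_mul]
  refine add_le_add ?_ ?_
  · exact mul_le_mul h2 h3 hl2.le (by positivity)
  · calc 3 ^ d * ((n : ℝ) * 2 ^ d) * Real.log 2 = 3 ^ d * 2 ^ d * (n * Real.log 2) := by ring
      _ ≤ _ := by gcongr

/-! ### Moments and masses of shells -/

variable {d : ℕ}

theorem lintegral_le_of_momentRoot_le {q : ℝ≥0∞} (hq0 : q ≠ 0) (hq : q ≠ ∞)
    {μ : Measure (Space d)} {R : ℝ} (hR : 0 < R) (h : momentRoot q μ ≤ ENNReal.ofReal R) :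
    ∫⁻ x, ‖x‖ₑ ^ q.toReal ∂μ ≤ ENNReal.ofReal (R ^ q.toReal) := by
  have hq' : 0 < q.toReal := ENNReal.toReal_pos hq0 hq
  rw [momentRoot, eLpNorm_eq_lintegral_rpow_enorm_toReal hq0 hq, one_div,
    ENNReal.rpow_inv_le_iff hq', ENNReal.ofReal_rpow_of_pos hR] at h
  exact h

theorem tailMoment_le {p q : ℝ} (hpq : p < q) (μ : Measure (Space d)) {T : ℝ}
    (hT : 0 < T) : tailMoment p μ T ≤ ENNReal.ofReal (T ^ (p - q)) * tailMoment q μ T := by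
  unfold tailMoment
  rw [← lintegral_const_mul' _ _ ENNReal.ofReal_ne_top]
  refine setLIntegral_mono' measurableSet_closedBall.compl fun x hx => ?_
  rw [Set.mem_compl_iff, mem_closedBall_zero_iff, not_le] at hx
  have hx0 : 0 < ‖x‖ := hT.trans hx
  rw [← ofReal_norm, ENNReal.ofReal_rpow_of_pos hx0, ENNReal.ofReal_rpow_of_pos hx0,
    ← ENNReal.ofReal_mul (by positivity)]
  refine ENNReal.ofReal_le_ofReal ?_
  calc ‖x‖ ^ p = ‖x‖ ^ (p - q) * ‖x‖ ^ q := by rw [← Real.rpow_add hx0]; ring_nf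
    _ ≤ _ := by
      exact mul_le_mul_of_nonneg_right
        (Real.rpow_le_rpow_of_nonpos hT hx.le (by linarith)) (by positivity)

theorem tailMoment_anti {q : ℝ} (μ : Measure (Space d)) : Antitone (tailMoment q μ) := by
  intro T T' h
  exact lintegral_mono_set (Set.compl_subset_compl.2 (Metric.closedBall_subset_closedBall h))

theorem tailMoment_le_lintegral {q : ℝ} (μ : Measure (Space d)) (T : ℝ) :
    tailMoment q μ T ≤ ∫⁻ x, ‖x‖ₑ ^ q ∂μ := setLIntegral_le_lintegral _ _

theorem tendsto_tailMoment {q : ℝ} (μ : Measure (Space d)) [IsFiniteMeasure μ]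
    (h : ∫⁻ x, ‖x‖ₑ ^ q ∂μ ≠ ∞) : Tendsto (tailMoment q μ) atTop (𝓝 0) := by
  refine tendsto_setLIntegral_zero h ?_
  have h1 := tendsto_measure_iInter_atTop (μ := μ) (s := fun T : ℝ => (Metric.closedBall (0 : Space d) T)ᶜ)
    (fun T => measurableSet_closedBall.compl.nullMeasurableSet)
    (fun T T' hT => Set.compl_subset_compl.2 (Metric.closedBall_subset_closedBall hT))
    ⟨0, measure_ne_top _ _⟩
  have h2 : ⋂ T : ℝ, (Metric.closedBall (0 : Space d) T)ᶜ = ∅ := by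
    rw [← Set.compl_iUnion, Set.compl_empty_iff, Set.eq_univ_iff_forall]
    exact fun x => Set.mem_iUnion.2 ⟨‖x‖, by simp⟩
  rwa [h2, measure_empty] at h1

/-- The masses of the shells, weighted by the moment of order `q`, are summable. -/
theorem sum_measureReal_shell_le {q : ℝ} (hq : 0 < q) (μ : Measure (Space d))
    [IsProbabilityMeasure μ] {R : ℝ} (hR : 0 < R)
    (h : ∫⁻ x, ‖x‖ₑ ^ q ∂μ ≤ ENNReal.ofReal (R ^ q)) (J : ℕ) :
    ∑ j ∈ Finset.range (J + 1), ((2 : ℝ) ^ j) ^ q * μ.real (shell d R j) ≤ 2 ^ q + 1 := by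
  rw [Finset.sum_range_succ']
  -- The innermost ball gives the summand `1`. On shell `j + 1` the norm is only known to exceed `R
  -- 2^j`, whence the factor `2^q`.
  refine add_le_add ?_ (by simp)
  have h1 : ∀ j, ENNReal.ofReal ((R * 2 ^ j) ^ q * μ.real (shell d R (j + 1))) ≤
      ∫⁻ x in shell d R (j + 1), ‖x‖ₑ ^ q ∂μ := by
    intro j
    rw [ENNReal.ofReal_mul (by positivity), ofReal_measureReal, ← setLIntegral_const]
    refine setLIntegral_mono' (measurableSet_shell d R _) fun x hx => ?_
    have hx' : R * 2 ^ j < ‖x‖ := by simpa using hx.2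
    rw [← ENNReal.ofReal_rpow_of_pos (by positivity), ← ofReal_norm]
    gcongr
  have h2 : ENNReal.ofReal (∑ j ∈ Finset.range J, (R * 2 ^ j) ^ q * μ.real (shell d R (j + 1))) ≤
      ENNReal.ofReal (R ^ q) := by
    rw [ENNReal.ofReal_sum_of_nonneg fun _ _ => by positivity]
    refine (Finset.sum_le_sum fun j _ => h1 j).trans (le_trans ?_ h)
    rw [← lintegral_finsetSum_measure]
    refine lintegral_mono' ?_ le_rfl
    have h3 := restrict_closedBall_eq_sum_shell μ hR J
    rw [Finset.sum_range_succ'] at h3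
    calc _ ≤ _ := Measure.le_add_right le_rfl
      _ = _ := h3.symm
      _ ≤ μ := Measure.restrict_le_self
  rw [ENNReal.ofReal_le_ofReal_iff (by positivity)] at h2
  have h4 : ∑ j ∈ Finset.range J, (R * 2 ^ j) ^ q * μ.real (shell d R (j + 1)) =
      R ^ q * ∑ j ∈ Finset.range J, ((2 : ℝ) ^ j) ^ q * μ.real (shell d R (j + 1)) := by
    rw [Finset.mul_sum]
    refine Finset.sum_congr rfl fun j _ => ?_
    rw [Real.mul_rpow hR.le (by positivity), mul_assoc]
  rw [h4] at h2
  have h5 : ∑ j ∈ Finset.range J, ((2 : ℝ) ^ j) ^ q * μ.real (shell d R (j + 1)) ≤ 1 :=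
    le_of_mul_le_mul_left (by simpa using h2) (by positivity : 0 < R ^ q)
  calc ∑ j ∈ Finset.range J, ((2 : ℝ) ^ (j + 1)) ^ q * μ.real (shell d R (j + 1))
      = 2 ^ q * ∑ j ∈ Finset.range J, ((2 : ℝ) ^ j) ^ q * μ.real (shell d R (j + 1)) := by
        rw [Finset.mul_sum]
        refine Finset.sum_congr rfl fun j _ => ?_
        rw [pow_succ', Real.mul_rpow (by norm_num) (by positivity), mul_assoc]
    _ ≤ 2 ^ q * 1 := by gcongr
    _ = 2 ^ q := mul_one _

/-! ### Cutoff radius and sums over shells -/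

theorem sum_two_pow_rpow_le {a r s : ℝ} (ha : 0 < a) (hr : 0 < r) {J : ℕ}
    (h : ((2 : ℝ) ^ J) ^ r ≤ s) :
    ∑ j ∈ Finset.range (J + 1), ((2 : ℝ) ^ j) ^ a ≤ 2 ^ a / (2 ^ a - 1) * s ^ (a / r) := by
  have h1 : (1 : ℝ) < 2 ^ a := Real.one_lt_rpow (by norm_num) ha
  have h2 : (0 : ℝ) < 2 ^ a - 1 := by linarith
  have h3 : ((2 : ℝ) ^ a) ^ J ≤ s ^ (a / r) := by
    rw [← two_pow_rpow, show a = r * (a / r) by field_simp, Real.rpow_mul (by positivity),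
      mul_div_cancel_left₀ _ hr.ne']
    exact Real.rpow_le_rpow (by positivity) h (by positivity)
  simp only [two_pow_rpow]
  refine (geom_sum_range_le h1 _).trans ?_
  rw [pow_succ', div_mul_eq_mul_div]
  gcongr

theorem exists_outer_scale {r s : ℝ} (hr : 0 < r) (hs : 1 ≤ s) :
    ∃ J : ℕ, ((2 : ℝ) ^ J) ^ r ≤ s ∧ s ^ (1 / r) / 2 ≤ 2 ^ J := by
  obtain ⟨J, h1, h2⟩ := exists_nat_pow_near hs (Real.one_lt_rpow (by norm_num) hr : (1 : ℝ) < 2 ^ r)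
  refine ⟨J, by rwa [two_pow_rpow], ?_⟩
  rw [div_le_iff₀ (by norm_num), ← pow_succ, one_div,
    Real.rpow_inv_le_iff_of_pos (by linarith) (by positivity) hr, two_pow_rpow]
  exact h2.le

/-- The cutoff radius is comparable to `R s^(1/r)`, with `s` free and `C` independent of it: `s = N`
gives the rates, `s = εN` the limit. The tail moment is kept because the limit needs its decay. -/
theorem quantError_le_scaled {p r θ K : ℝ} (hp : 0 < p) (hpr : p < r) (hK : 0 < K)
    (hΨ : IsProfile d p fun t => K * t ^ θ) :
    ∃ C, 0 < C ∧ ∀ (N : ℕ), 1 ≤ N → ∀ (R : ℝ), 0 < R → ∀ (μ : Measure (Space d)),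
      IsProbabilityMeasure μ → ∀ s : ℝ, 1 ≤ s → ∃ J : ℕ, ((2 : ℝ) ^ J) ^ r ≤ s ∧
        quantError N p μ ≤ (ENNReal.ofReal (C * R ^ p * (s ^ (p / r) / N + (N : ℝ) ^ (θ - 1) *
          ∑ j ∈ Finset.range (J + 1), ((2 : ℝ) ^ j) ^ p * μ.real (shell d R j) ^ θ)) +
          ENNReal.ofReal (C * R ^ (p - r) * s ^ (p / r - 1)) *
            tailMoment r μ (R * (s ^ (1 / r) / 2))) ^ (1 / p) := by
  have hr : 0 < r := hp.trans hpr
  have h1 : (1 : ℝ) < 2 ^ p := Real.one_lt_rpow (by norm_num) hp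
  have h2 : (0 : ℝ) < 2 ^ p - 1 := by linarith
  set D : ℝ := √d ^ p + 3 ^ d with hD
  have hD0 : 0 < D := by positivity
  set c : ℝ := 2 ^ p / (2 ^ p - 1) with hc
  have hc0 : 0 < c := by positivity
  -- `D * (c + K)` serves the shells; `2 ^ (r - p)` pays for the factor `2` lost in rounding the
  -- cutoff to a power of two.
  refine ⟨D * (c + K) + 2 ^ (r - p), by positivity, fun N hN R hR μ _ s hs => ?_⟩
  have hN0 : (0 : ℝ) < N := by exact_mod_cast hN
  have hs0 : 0 < s := by linarith
  obtain ⟨J, hJ1, hJ2⟩ := exists_outer_scale hr hs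
  refine ⟨J, hJ1, (hΨ.quantError_le hp hN hR μ J).trans (ENNReal.rpow_le_rpow ?_ (by positivity))⟩
  set S := ∑ j ∈ Finset.range (J + 1), ((2 : ℝ) ^ j) ^ p * μ.real (shell d R j) ^ θ with hS
  have hS0 : 0 ≤ S := Finset.sum_nonneg fun _ _ => by positivity
  refine add_le_add (ENNReal.ofReal_le_ofReal ?_) ((tailMoment_le hpr μ (by positivity)).trans
    (mul_le_mul' (ENNReal.ofReal_le_ofReal ?_) (tailMoment_anti μ (by gcongr))))
  · have e : ∑ j ∈ Finset.range (J + 1), ((2 : ℝ) ^ j) ^ p *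
        (1 + K * (N * μ.real (shell d R j)) ^ θ) =
        ∑ j ∈ Finset.range (J + 1), ((2 : ℝ) ^ j) ^ p + K * (N : ℝ) ^ θ * S := by
      rw [hS, Finset.mul_sum, ← Finset.sum_add_distrib]
      refine Finset.sum_congr rfl fun j _ => ?_
      rw [Real.mul_rpow hN0.le (by positivity)]
      ring
    rw [e, add_div]
    have e2 : K * (N : ℝ) ^ θ * S / N = K * ((N : ℝ) ^ (θ - 1) * S) := by
      rw [Real.rpow_sub_one hN0.ne']; ring
    rw [e2]
    have e3 := sum_two_pow_rpow_le hp hr hJ1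
    rw [← hc] at e3
    have e4 : (∑ j ∈ Finset.range (J + 1), ((2 : ℝ) ^ j) ^ p) / N ≤ c * (s ^ (p / r) / N) := by
      rw [← mul_div_assoc]; gcongr
    set u := s ^ (p / r) / (N : ℝ) with hu
    set v := (N : ℝ) ^ (θ - 1) * S with hv
    have hu0 : 0 ≤ u := by positivity
    have hv0 : 0 ≤ v := by positivity
    calc _ ≤ D * R ^ p * (c * u + K * v) := by gcongr
      _ ≤ D * R ^ p * ((c + K) * (u + v)) := by gcongr; nlinarith
      _ = D * (c + K) * (R ^ p * (u + v)) := by ring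
      _ ≤ (D * (c + K) + 2 ^ (r - p)) * (R ^ p * (u + v)) := by
        gcongr; exact le_add_of_nonneg_right (by positivity)
      _ = _ := by ring
  · rw [Real.mul_rpow hR.le (by positivity)]
    have e1 : ((2 : ℝ) ^ J) ^ (p - r) ≤ (s ^ (1 / r) / 2) ^ (p - r) :=
      Real.rpow_le_rpow_of_nonpos (by positivity) hJ2 (by linarith)
    have e2 : (s ^ (1 / r) / 2) ^ (p - r) = 2 ^ (r - p) * s ^ (p / r - 1) := by
      rw [Real.div_rpow (by positivity) (by norm_num), ← Real.rpow_mul hs0.le,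
        show 1 / r * (p - r) = p / r - 1 by field_simp, show r - p = -(p - r) by ring,
        Real.rpow_neg (by norm_num)]
      field_simp
    rw [e2] at e1
    calc R ^ (p - r) * ((2 : ℝ) ^ J) ^ (p - r) ≤ R ^ (p - r) * (2 ^ (r - p) * s ^ (p / r - 1)) := by
          gcongr
      _ = 2 ^ (r - p) * (R ^ (p - r) * s ^ (p / r - 1)) := by ring
      _ ≤ (D * (c + K) + 2 ^ (r - p)) * (R ^ (p - r) * s ^ (p / r - 1)) := by
        gcongr; exact le_add_of_nonneg_left (by positivity)
      _ = _ := by ring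

theorem quantError_le_of_moment {p r θ K : ℝ} (hp : 0 < p) (hpr : p < r) (hK : 0 < K)
    (hΨ : IsProfile d p fun t => K * t ^ θ) :
    ∃ C, 0 < C ∧ ∀ (N : ℕ), 1 ≤ N → ∀ (R : ℝ), 0 < R → ∀ (μ : Measure (Space d)),
      IsProbabilityMeasure μ → ∫⁻ x, ‖x‖ₑ ^ r ∂μ ≤ ENNReal.ofReal (R ^ r) →
      ∃ J : ℕ, ((2 : ℝ) ^ J) ^ r ≤ N ∧
        quantError N p μ ≤ (ENNReal.ofReal (C * R ^ p * ((N : ℝ) ^ (p / r - 1) +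
          (N : ℝ) ^ (θ - 1) * ∑ j ∈ Finset.range (J + 1),
            ((2 : ℝ) ^ j) ^ p * μ.real (shell d R j) ^ θ))) ^ (1 / p) := by
  obtain ⟨C, hC, h⟩ := quantError_le_scaled hp hpr hK hΨ
  refine ⟨2 * C, by positivity, fun N hN R hR μ hμ hm => ?_⟩
  have hN0 : (0 : ℝ) < N := by exact_mod_cast hN
  obtain ⟨J, hJ, hb⟩ := h N hN R hR μ hμ N (by exact_mod_cast hN)
  refine ⟨J, hJ, hb.trans (ENNReal.rpow_le_rpow ?_ (by positivity))⟩
  set S := ∑ j ∈ Finset.range (J + 1), ((2 : ℝ) ^ j) ^ p * μ.real (shell d R j) ^ θ with hS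
  have hS0 : 0 ≤ S := Finset.sum_nonneg fun _ _ => by positivity
  refine (add_le_add le_rfl (mul_le_mul_right ((tailMoment_le_lintegral μ _).trans hm) _)).trans ?_
  rw [← ENNReal.ofReal_mul (by positivity), ← ENNReal.ofReal_add (by positivity) (by positivity)]
  refine ENNReal.ofReal_le_ofReal ?_
  rw [← Real.rpow_sub_one hN0.ne']
  have e : C * R ^ (p - r) * (N : ℝ) ^ (p / r - 1) * R ^ r = C * R ^ p * (N : ℝ) ^ (p / r - 1) := by
    have : R ^ (p - r) * R ^ r = R ^ p := by rw [← Real.rpow_add hR]; ring_nf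
    rw [← this]; ring
  rw [e]
  have h0 : 0 ≤ C * R ^ p * ((N : ℝ) ^ (θ - 1) * S) := by positivity
  linarith

/-- Markov's inequality on one shell, raised to the power `θ`; the sign of `p - rθ` then decides
which shells dominate. -/
theorem measureReal_shell_rpow_le {p r θ : ℝ} (hr : 0 < r) (hθ : 0 < θ) (μ : Measure (Space d))
    [IsProbabilityMeasure μ] {R : ℝ} (hR : 0 < R)
    (h : ∫⁻ x, ‖x‖ₑ ^ r ∂μ ≤ ENNReal.ofReal (R ^ r)) (j : ℕ) :
    ((2 : ℝ) ^ j) ^ p * μ.real (shell d R j) ^ θ ≤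
      (2 ^ r + 1) ^ θ * ((2 : ℝ) ^ j) ^ (p - r * θ) := by
  have h1 : ((2 : ℝ) ^ j) ^ r * μ.real (shell d R j) ≤ 2 ^ r + 1 :=
    (Finset.single_le_sum (f := fun j => ((2 : ℝ) ^ j) ^ r * μ.real (shell d R j))
      (fun _ _ => by positivity) (Finset.self_mem_range_succ j)).trans
        (sum_measureReal_shell_le hr μ hR h j)
  have h2 := Real.rpow_le_rpow (by positivity) h1 hθ.le
  rw [Real.mul_rpow (by positivity) (by positivity), ← Real.rpow_mul (by positivity)] at h2
  calc ((2 : ℝ) ^ j) ^ p * μ.real (shell d R j) ^ θ =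
      (((2 : ℝ) ^ j) ^ (r * θ) * μ.real (shell d R j) ^ θ) * ((2 : ℝ) ^ j) ^ (p - r * θ) := by
        rw [Real.rpow_sub (by positivity)]; field_simp
    _ ≤ _ := by gcongr

/-- Shell sum in the regime where the outermost shells dominate. -/
theorem sum_shell_le_of_lt {p r θ : ℝ} (hr : 0 < r) (hθ : 0 < θ) (hθr : θ < p / r) :
    ∃ C, 0 < C ∧ ∀ (R : ℝ), 0 < R → ∀ (μ : Measure (Space d)), IsProbabilityMeasure μ →
      ∫⁻ x, ‖x‖ₑ ^ r ∂μ ≤ ENNReal.ofReal (R ^ r) → ∀ (s : ℝ) (J : ℕ), ((2 : ℝ) ^ J) ^ r ≤ s →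
      ∑ j ∈ Finset.range (J + 1), ((2 : ℝ) ^ j) ^ p * μ.real (shell d R j) ^ θ ≤
        C * s ^ (p / r - θ) := by
  have ha : 0 < p - r * θ := by rw [lt_div_iff₀ hr] at hθr; linarith
  have h1 : (1 : ℝ) < 2 ^ (p - r * θ) := Real.one_lt_rpow (by norm_num) ha
  have h2 : (0 : ℝ) < 2 ^ (p - r * θ) - 1 := by linarith
  refine ⟨(2 ^ r + 1) ^ θ * (2 ^ (p - r * θ) / (2 ^ (p - r * θ) - 1)), by positivity,
    fun R hR μ _ hm s J hJ => ?_⟩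
  refine (Finset.sum_le_sum fun j _ => measureReal_shell_rpow_le hr hθ μ hR hm j).trans ?_
  rw [← Finset.mul_sum, mul_assoc, show p / r - θ = (p - r * θ) / r by field_simp]
  gcongr
  exact sum_two_pow_rpow_le ha hr hJ

/-- Shell sum in the regime where the innermost shells dominate. -/
theorem sum_shell_le_of_gt {p r θ : ℝ} (hr : 0 < r) (hθ : 0 < θ) (hθr : p / r < θ) :
    ∃ C, 0 < C ∧ ∀ (R : ℝ), 0 < R → ∀ (μ : Measure (Space d)), IsProbabilityMeasure μ →
      ∫⁻ x, ‖x‖ₑ ^ r ∂μ ≤ ENNReal.ofReal (R ^ r) → ∀ (J : ℕ),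
      ∑ j ∈ Finset.range (J + 1), ((2 : ℝ) ^ j) ^ p * μ.real (shell d R j) ^ θ ≤ C := by
  have ha : p - r * θ < 0 := by rw [div_lt_iff₀ hr] at hθr; linarith
  have h1 : (2 : ℝ) ^ (p - r * θ) < 1 := Real.rpow_lt_one_of_one_lt_of_neg (by norm_num) ha
  have h2 : 0 < 1 - (2 : ℝ) ^ (p - r * θ) := by linarith
  refine ⟨(2 ^ r + 1) ^ θ * (1 / (1 - 2 ^ (p - r * θ))), by positivity, fun R hR μ _ hm J => ?_⟩
  refine (Finset.sum_le_sum fun j _ => measureReal_shell_rpow_le hr hθ μ hR hm j).trans ?_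
  rw [← Finset.mul_sum]
  gcongr
  simp only [two_pow_rpow]
  exact geom_sum_range_le_of_lt_one (by positivity) h1 _

/-- Shell sum in the critical regime, where all shells contribute. -/
theorem sum_shell_le_critical {p r : ℝ} (hp : 0 < p) (hpr : p < r) :
    ∃ C, 0 < C ∧ ∀ (R : ℝ), 0 < R → ∀ (μ : Measure (Space d)), IsProbabilityMeasure μ →
      ∫⁻ x, ‖x‖ₑ ^ r ∂μ ≤ ENNReal.ofReal (R ^ r) → ∀ (N J : ℕ), 1 ≤ N → ((2 : ℝ) ^ J) ^ r ≤ N →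
      ∑ j ∈ Finset.range (J + 1), ((2 : ℝ) ^ j) ^ p * μ.real (shell d R j) ^ (p / r) ≤
        C * Real.log (1 + N) ^ (1 - p / r) := by
  have hr : 0 < r := hp.trans hpr
  have hl2 : 0 < Real.log 2 := Real.log_pos (by norm_num)
  have hθ1 : 0 < 1 - p / r := by rw [sub_pos, div_lt_one hr]; exact hpr
  set θ := p / r with hθ
  have hθ0 : 0 < θ := by positivity
  set c : ℝ := (1 / r + 1) / Real.log 2 with hc
  refine ⟨c ^ (1 - θ) * (2 ^ r + 1) ^ θ, by positivity, fun R hR μ _ hm N J hN hJ => ?_⟩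
  have hN1 : (1 : ℝ) ≤ N := by exact_mod_cast hN
  have hlog0 : 0 ≤ Real.log (1 + N) := Real.log_nonneg (by linarith)
  -- The number of shells is logarithmic in `N`; the extra `1` is absorbed by `log 2 ≤ log (1 + N)`.
  have hJc : (J : ℝ) + 1 ≤ c * Real.log (1 + N) := by
    have h1 : Real.log 2 ≤ Real.log (1 + N) := Real.log_le_log (by norm_num) (by linarith)
    have h2 : r * (J * Real.log 2) ≤ Real.log (1 + N) := by
      rw [← Real.log_pow, ← Real.log_rpow (by positivity)]
      exact Real.log_le_log (by positivity) (by linarith)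
    rw [hc, div_mul_eq_mul_div, le_div_iff₀ hl2, add_mul, add_mul, one_mul, one_mul]
    refine add_le_add ?_ h1
    rw [div_mul_eq_mul_div, one_mul, le_div_iff₀ hr]
    linarith
  have hterm : ∀ j : ℕ, ((2 : ℝ) ^ j) ^ p * μ.real (shell d R j) ^ θ =
      (((2 : ℝ) ^ j) ^ r * μ.real (shell d R j)) ^ θ := by
    intro j
    rw [Real.mul_rpow (by positivity) (by positivity), ← Real.rpow_mul (by positivity), hθ,
      mul_div_cancel₀ _ hr.ne']
  set y : ℕ → ℝ := fun j => ((2 : ℝ) ^ j) ^ r * μ.real (shell d R j) with hy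
  have hy0 : ∀ j, 0 ≤ y j := fun j => by positivity
  have hθle : 1 ≤ 1 / θ := by rw [one_le_div hθ0]; linarith
  -- The power mean inequality uses the bound on the whole sum of the `y j`. Bounding each term
  -- separately would give the number of shells to the power `1` instead of `1 - θ`.
  have hJensen := Real.rpow_sum_le_const_mul_sum_rpow_of_nonneg (s := Finset.range (J + 1))
    (f := fun j => y j ^ θ) hθle (fun j _ => Real.rpow_nonneg (hy0 j) θ)
  simp only [Finset.card_range] at hJensen
  have e1 : ∀ j, (y j ^ θ) ^ (1 / θ) = y j := fun j => by
    rw [← Real.rpow_mul (hy0 j), mul_one_div_cancel hθ0.ne', Real.rpow_one]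
  simp only [e1] at hJensen
  have hT0 : 0 ≤ ∑ j ∈ Finset.range (J + 1), y j ^ θ :=
    Finset.sum_nonneg fun j _ => Real.rpow_nonneg (hy0 j) θ
  have h3 : (∑ j ∈ Finset.range (J + 1), y j ^ θ) ^ (1 / θ) ≤
      ((J + 1 : ℕ) : ℝ) ^ (1 / θ - 1) * (2 ^ r + 1) :=
    hJensen.trans (by gcongr; exact sum_measureReal_shell_le hr μ hR hm J)
  have h4 := Real.rpow_le_rpow (by positivity) h3 hθ0.le
  rw [← Real.rpow_mul hT0, one_div_mul_cancel hθ0.ne', Real.rpow_one,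
    Real.mul_rpow (by positivity) (by positivity), ← Real.rpow_mul (by positivity),
    sub_mul, one_div_mul_cancel hθ0.ne', one_mul] at h4
  simp only [hterm]
  refine h4.trans ?_
  calc ((J + 1 : ℕ) : ℝ) ^ (1 - θ) * (2 ^ r + 1) ^ θ
      ≤ (c * Real.log (1 + N)) ^ (1 - θ) * (2 ^ r + 1) ^ θ := by
        push_cast; gcongr
    _ = _ := by rw [Real.mul_rpow (by positivity) hlog0]; ring

/-! ### From cost bounds to rates -/

theorem ofReal_rpow_one_div_le {p R ρ C X : ℝ} (hp : 0 < p) (hR : 0 ≤ R) (hρ : 0 ≤ ρ)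
    (hC : 0 ≤ C) (h : X ≤ C * R ^ p * ρ ^ p) :
    ENNReal.ofReal X ^ (1 / p) ≤
      ENNReal.ofReal (C ^ (1 / p)) * ENNReal.ofReal R * ENNReal.ofReal ρ := by
  have e : C * R ^ p * ρ ^ p = (C ^ (1 / p) * R * ρ) ^ p := by
    rw [Real.mul_rpow (by positivity) hρ, Real.mul_rpow (by positivity) hR,
      ← Real.rpow_mul hC, one_div_mul_cancel hp.ne', Real.rpow_one]
  rw [one_div] at e ⊢
  rw [← ENNReal.ofReal_mul (by positivity), ← ENNReal.ofReal_mul (by positivity),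
    ENNReal.rpow_inv_le_iff hp, ENNReal.ofReal_rpow_of_nonneg (by positivity) hp.le, ← e]
  exact ENNReal.ofReal_le_ofReal h

/-- The shells need `R > 0`, so a vanishing moment is reached by letting `R` decrease to `0`. -/
theorem le_mul_mul_of_forall_ofReal {e c M ρ : ℝ≥0∞} (hM : M < ∞) (hc : c ≠ ∞) (hρ : ρ ≠ ∞)
    (h : ∀ R : ℝ, 0 < R → M ≤ ENNReal.ofReal R → e ≤ c * ENNReal.ofReal R * ρ) :
    e ≤ c * M * ρ := by
  by_cases hM0 : M = 0
  · have h1 : Tendsto (fun R : ℝ => c * ENNReal.ofReal R * ρ) (𝓝[>] 0) (𝓝 (c * M * ρ)) := by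
      have h2 : Tendsto ENNReal.ofReal (𝓝[>] 0) (𝓝 M) := by
        rw [hM0, ← ENNReal.ofReal_zero]
        exact ENNReal.continuous_ofReal.continuousWithinAt
      exact ENNReal.Tendsto.mul_const (ENNReal.Tendsto.const_mul h2 (Or.inr hc)) (Or.inr hρ)
    refine ge_of_tendsto h1 ?_
    filter_upwards [self_mem_nhdsWithin] with R hR
    exact h R hR (by simp [hM0])
  · have h1 := h M.toReal (ENNReal.toReal_pos hM0 hM.ne) (by rw [ENNReal.ofReal_toReal hM.ne])
    rwa [ENNReal.ofReal_toReal hM.ne] at h1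

/-- The rate `ρ` bounds the quantization error, up to a constant and the moment of order `q`. -/
def HasRate (d : ℕ) (p : ℝ) (q : ℝ≥0∞) (ρ : ℕ → ℝ) : Prop :=
  ∃ C : ℝ, 0 < C ∧ ∀ N : ℕ, 1 ≤ N → ∀ μ : Measure (Space d), IsProbabilityMeasure μ →
    ∀ R : ℝ, 0 < R → momentRoot q μ ≤ ENNReal.ofReal R →
      quantError N p μ ≤ ENNReal.ofReal C * ENNReal.ofReal R * ENNReal.ofReal (ρ N)

theorem HasRate.le_momentRoot {p : ℝ} {q : ℝ≥0∞} {ρ : ℕ → ℝ} (h : HasRate d p q ρ) :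
    ∃ C : ℝ, 0 < C ∧ ∀ N : ℕ, 1 ≤ N → ∀ μ ∈ FiniteMoment d q,
      quantError N p μ ≤ ENNReal.ofReal C * momentRoot q μ * ENNReal.ofReal (ρ N) := by
  obtain ⟨C, hC, h⟩ := h
  exact ⟨C, hC, fun N hN μ hμ => le_mul_mul_of_forall_ofReal hμ.2 ENNReal.ofReal_ne_top
    ENNReal.ofReal_ne_top fun R hR hM => h N hN μ hμ.1 R hR hM⟩

/-! ### Bounded support -/

/-- The ball of radius `R` carries all the mass: take `J = 0`, with no tail. -/
theorem hasRate_top_of_profile {p : ℝ} (hp : 0 < p) {Ψ : ℝ → ℝ}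
    (hΨ : IsProfile d p Ψ) {ρ : ℕ → ℝ} (hρ : ∀ N, 0 ≤ ρ N) {C : ℝ} (hC : 0 < C)
    (h : ∀ N : ℕ, 1 ≤ N → (1 + Ψ N) / N ≤ C * ρ N ^ p) : HasRate d p ∞ ρ := by
  set D : ℝ := √d ^ p + 3 ^ d with hD
  have hD0 : 0 < D := by positivity
  refine ⟨(D * C) ^ (1 / p), by positivity, fun N hN μ _ R hR hM => ?_⟩
  have hae : ∀ᵐ x ∂μ, x ∈ Metric.closedBall (0 : Space d) R := by
    rw [momentRoot, eLpNorm_exponent_top] at hM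
    filter_upwards [ae_le_eLpNormEssSup (f := fun x : Space d => x) (μ := μ)] with x hx
    have h1 := hx.trans hM
    rw [← ofReal_norm, ENNReal.ofReal_le_ofReal_iff hR.le] at h1
    simpa using h1
  have h0 : μ (Metric.closedBall 0 R)ᶜ = 0 := hae
  have hb := hΨ.quantError_le hp hN hR μ 0
  have h1 : tailMoment p μ (R * 2 ^ 0) = 0 := by
    rw [pow_zero, mul_one, tailMoment, Measure.restrict_eq_zero.2 h0, lintegral_zero_measure]
  have h2 : μ.real (shell d R 0) = 1 := by
    rw [shell, measureReal_def, (prob_compl_eq_zero_iff measurableSet_closedBall).1 h0,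
      ENNReal.toReal_one]
  rw [h1, add_zero] at hb
  simp only [zero_add, Finset.range_one, Finset.sum_singleton, pow_zero, Real.one_rpow, one_mul,
    h2, mul_one] at hb
  refine hb.trans (ofReal_rpow_one_div_le hp hR.le (hρ N) (by positivity) ?_)
  calc D * R ^ p * ((1 + Ψ N) / N) ≤ D * R ^ p * (C * ρ N ^ p) := by gcongr; exact h N hN
    _ = _ := by ring

theorem hasRate_top_of_ne (hd : 1 ≤ d) {p : ℝ} (hp : 0 < p) (hdp : (d : ℝ) ≠ p) :
    HasRate d p ∞ fun N => max ((N : ℝ) ^ (-1 / (d : ℝ))) ((N : ℝ) ^ (-1 / p + recip ∞)) := by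
  have hd0 : (0 : ℝ) < d := by exact_mod_cast hd
  have hr : recip ∞ = 0 := by simp [recip]
  rw [hr, add_zero]
  rcases lt_or_gt_of_ne hdp with h | h
  · obtain ⟨K, hK, hΨ⟩ := isProfile_const hd h
    refine hasRate_top_of_profile hp hΨ (fun N => by positivity) (C := 1 + K) (by positivity)
      fun N hN => ?_
    have hN0 : (0 : ℝ) < N := by exact_mod_cast hN
    rw [div_eq_mul_inv]
    gcongr
    calc (N : ℝ)⁻¹ = ((N : ℝ) ^ (-1 / p)) ^ p := by
          rw [← Real.rpow_mul hN0.le, div_mul_cancel₀ _ hp.ne', Real.rpow_neg_one]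
      _ ≤ _ := by gcongr; exact le_max_right _ _
  · have hθ : 0 < 1 - p / d := by rw [sub_pos, div_lt_one hd0]; exact h
    obtain ⟨K, hK, hΨ⟩ := isProfile_rpow hd hp hθ le_rfl
    refine hasRate_top_of_profile hp hΨ (fun N => by positivity) (C := 1 + K) (by positivity)
      fun N hN => ?_
    have hN0 : (0 : ℝ) < N := by exact_mod_cast hN
    have h1 : 1 ≤ (N : ℝ) ^ (1 - p / d) := Real.one_le_rpow (by exact_mod_cast hN) hθ.le
    calc (1 + K * (N : ℝ) ^ (1 - p / d)) / N ≤ ((1 + K) * (N : ℝ) ^ (1 - p / d)) / N := by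
          gcongr; linarith
      _ = (1 + K) * ((N : ℝ) ^ (-1 / (d : ℝ))) ^ p := by
          rw [← Real.rpow_mul hN0.le, mul_div_assoc, ← Real.rpow_sub_one hN0.ne']
          congr 2; ring
      _ ≤ _ := by gcongr; exact le_max_left _ _

theorem hasRate_top_critical (hd : 1 ≤ d) {p : ℝ} (hp : 0 < p) (hdp : (d : ℝ) = p) :
    HasRate d p ∞ fun N => (N : ℝ) ^ (-1 / (d : ℝ)) * Real.log (1 + N) ^ (1 / (d : ℝ)) := by
  have hl2 : 0 < Real.log 2 := Real.log_pos (by norm_num)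
  obtain ⟨K, hK, hΨ⟩ := isProfile_log hd hdp
  have hlog : ∀ N : ℕ, 0 ≤ Real.log (1 + N) := fun N => Real.log_nonneg (by simp)
  refine hasRate_top_of_profile hp hΨ (fun N => mul_nonneg (by positivity)
    (Real.rpow_nonneg (hlog N) _)) (C := 1 / Real.log 2 + K) (by positivity) fun N hN => ?_
  have hN1 : (1 : ℝ) ≤ N := by exact_mod_cast hN
  have hN0 : (0 : ℝ) < N := by linarith
  have h1 : Real.log 2 ≤ Real.log (1 + N) := Real.log_le_log (by norm_num) (by linarith)
  rw [Real.mul_rpow (by positivity) (Real.rpow_nonneg (hlog N) _), ← Real.rpow_mul hN0.le,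
    ← Real.rpow_mul (hlog N), hdp, div_mul_cancel₀ _ hp.ne', div_mul_cancel₀ _ hp.ne',
    Real.rpow_neg_one, Real.rpow_one, div_le_iff₀ hN0]
  have h2 : 1 ≤ 1 / Real.log 2 * Real.log (1 + N) := by
    rw [div_mul_eq_mul_div, one_mul, one_le_div hl2]; exact h1
  calc 1 + K * Real.log (1 + N) ≤ (1 / Real.log 2 + K) * Real.log (1 + N) := by linarith
    _ = _ := by field_simp

/-! ### Finite moments -/

variable {p : ℝ} {q : ℝ≥0∞}

theorem recip_eq_one_div (q : ℝ≥0∞) : recip q = 1 / q.toReal := by simp [recip, ENNReal.toReal_inv]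

/-- This turns the position of `d` into a comparison between the smallest exponent allowed by dyadic
scales and the one at which the shell sum is balanced. -/
theorem lt_criticalDim_iff (hd : 1 ≤ d) (hq : q ≠ ∞) (hp : 0 < p) (hpq : p < q.toReal) :
    (d : ℝ) < criticalDim p q ↔ 1 - p / d < p / q.toReal := by
  have hd0 : (0 : ℝ) < d := by exact_mod_cast hd
  have hr : 0 < q.toReal := hp.trans hpq
  rw [criticalDim, if_neg hq, lt_div_iff₀ (sub_pos.2 hpq), sub_lt_iff_lt_add',
    div_add_div _ _ hd0.ne' hr.ne', lt_div_iff₀ (by positivity)]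
  constructor <;> intro h <;> linarith

theorem eq_criticalDim_iff (hd : 1 ≤ d) (hq : q ≠ ∞) (hp : 0 < p) (hpq : p < q.toReal) :
    (d : ℝ) = criticalDim p q ↔ 1 - p / d = p / q.toReal := by
  have hd0 : (0 : ℝ) < d := by exact_mod_cast hd
  have hr : 0 < q.toReal := hp.trans hpq
  rw [criticalDim, if_neg hq, eq_div_iff (sub_pos.2 hpq).ne', sub_eq_iff_eq_add',
    div_add_div _ _ hd0.ne' hr.ne', eq_div_iff (by positivity)]
  constructor <;> intro h <;> linarith

theorem exists_exponent {a : ℝ} (ha : 0 < a) (h : 1 - p / d < a) :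
    ∃ θ, 0 < θ ∧ 1 - p / d ≤ θ ∧ θ < a := by
  refine ⟨(max 0 (1 - p / d) + a) / 2, ?_, ?_, ?_⟩
  · have := le_max_left 0 (1 - p / d); linarith
  · have := le_max_right 0 (1 - p / d); linarith
  · have := max_lt ha h; linarith

theorem hasRate_of_ne (hd : 1 ≤ d) (hq : q ≠ ∞) (hp : 0 < p) (hpq : p < q.toReal)
    (hdp : (d : ℝ) ≠ criticalDim p q) :
    HasRate d p q fun N => max ((N : ℝ) ^ (-1 / (d : ℝ))) ((N : ℝ) ^ (-1 / p + recip q)) := by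
  have hd0 : (0 : ℝ) < d := by exact_mod_cast hd
  have hr : 0 < q.toReal := hp.trans hpq
  have hq0 : q ≠ 0 := fun h => by simp [h] at hr
  rw [recip_eq_one_div]
  have hne : 1 - p / d ≠ p / q.toReal := fun h => hdp ((eq_criticalDim_iff hd hq hp hpq).2 h)
  set r := q.toReal with hrdef
  have hmax1 : ∀ N : ℕ, 1 ≤ N → (N : ℝ) ^ (p / r - 1) ≤
      max ((N : ℝ) ^ (-1 / (d : ℝ))) ((N : ℝ) ^ (-1 / p + 1 / r)) ^ p := fun N hN => by
    calc (N : ℝ) ^ (p / r - 1) = ((N : ℝ) ^ (-1 / p + 1 / r)) ^ p := by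
          rw [← Real.rpow_mul (by positivity)]; congr 1; field_simp; ring
      _ ≤ _ := by gcongr; exact le_max_right _ _
  have hmax2 : ∀ N : ℕ, 1 ≤ N → (N : ℝ) ^ (-(p / d)) ≤
      max ((N : ℝ) ^ (-1 / (d : ℝ))) ((N : ℝ) ^ (-1 / p + 1 / r)) ^ p := fun N hN => by
    calc (N : ℝ) ^ (-(p / d)) = ((N : ℝ) ^ (-1 / (d : ℝ))) ^ p := by
          rw [← Real.rpow_mul (by positivity)]; congr 1; ring
      _ ≤ _ := by gcongr; exact le_max_left _ _
  -- Below the critical dimension any admissible `θ < p/r` works, since `θ` cancels in `N^(θ-1)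
  -- N^(p/r-θ)`. Above it, `θ = 1 - p/d` exceeds `p/r` and the shell sum is bounded.
  obtain ⟨θ, hθ0, hθd, C', hC', hsum⟩ : ∃ θ, 0 < θ ∧ 1 - p / d ≤ θ ∧ ∃ C', 0 < C' ∧
      ∀ (R : ℝ), 0 < R → ∀ (μ : Measure (Space d)), IsProbabilityMeasure μ →
      ∫⁻ x, ‖x‖ₑ ^ r ∂μ ≤ ENNReal.ofReal (R ^ r) → ∀ (N J : ℕ), 1 ≤ N → ((2 : ℝ) ^ J) ^ r ≤ N →
      (N : ℝ) ^ (θ - 1) * ∑ j ∈ Finset.range (J + 1), ((2 : ℝ) ^ j) ^ p *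
        μ.real (shell d R j) ^ θ ≤
        C' * max ((N : ℝ) ^ (-1 / (d : ℝ))) ((N : ℝ) ^ (-1 / p + 1 / r)) ^ p := by
    rcases lt_or_gt_of_ne hne with h | h
    · obtain ⟨θ, h1, h2, h3⟩ := exists_exponent (by positivity) h
      obtain ⟨C, hC, hs⟩ := sum_shell_le_of_lt (d := d) hr h1 h3
      refine ⟨θ, h1, h2, C, hC, fun R hR μ hμ hm N J hN hJ => ?_⟩
      have hN0 : (0 : ℝ) < N := by exact_mod_cast hN
      calc _ ≤ (N : ℝ) ^ (θ - 1) * (C * (N : ℝ) ^ (p / r - θ)) := by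
            gcongr; exact hs R hR μ hμ hm N J hJ
        _ = C * ((N : ℝ) ^ (θ - 1) * (N : ℝ) ^ (p / r - θ)) := by ring
        _ = C * (N : ℝ) ^ (p / r - 1) := by rw [← Real.rpow_add hN0]; ring_nf
        _ ≤ _ := by gcongr; exact hmax1 N hN
    · have h1 : 0 < 1 - p / d := lt_trans (by positivity) h
      obtain ⟨C, hC, hs⟩ := sum_shell_le_of_gt (d := d) hr h1 h
      refine ⟨_, h1, le_rfl, C, hC, fun R hR μ hμ hm N J hN hJ => ?_⟩
      calc _ ≤ (N : ℝ) ^ (1 - p / d - 1) * C := by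
            gcongr; exact hs R hR μ hμ hm J
        _ = C * (N : ℝ) ^ (-(p / d)) := by rw [mul_comm]; ring_nf
        _ ≤ _ := by gcongr; exact hmax2 N hN
  obtain ⟨K, hK, hΨ⟩ := isProfile_rpow hd hp hθ0 hθd
  obtain ⟨C, hC, hb⟩ := quantError_le_of_moment hp hpq hK hΨ
  refine ⟨(C * (1 + C')) ^ (1 / p), by positivity, fun N hN μ hμ R hR hM => ?_⟩
  have hm := lintegral_le_of_momentRoot_le hq0 hq hR hM
  obtain ⟨J, hJ, hbJ⟩ := hb N hN R hR μ hμ hm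
  refine hbJ.trans (ofReal_rpow_one_div_le hp hR.le (by positivity) (by positivity) ?_)
  beta_reduce
  rw [show C * (1 + C') * R ^ p = C * R ^ p * (1 + C') by ring, mul_assoc (C * R ^ p), add_mul, one_mul]
  exact mul_le_mul_of_nonneg_left
    (add_le_add (hmax1 N hN) (hsum R hR μ hμ hm N J hN hJ)) (by positivity)

theorem hasRate_critical (hd : 1 ≤ d) (hq : q ≠ ∞) (hp : 0 < p) (hpq : p < q.toReal)
    (hdp : (d : ℝ) = criticalDim p q) :
    HasRate d p q fun N => (N : ℝ) ^ (-1 / (d : ℝ)) * Real.log (1 + N) ^ (1 / (d : ℝ)) := by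
  have hd0 : (0 : ℝ) < d := by exact_mod_cast hd
  have hr : 0 < q.toReal := hp.trans hpq
  have hq0 : q ≠ 0 := fun h => by simp [h] at hr
  have hl2 : 0 < Real.log 2 := Real.log_pos (by norm_num)
  have he : 1 - p / d = p / q.toReal := (eq_criticalDim_iff hd hq hp hpq).1 hdp
  have he' : 1 - p / q.toReal = p / d := by linarith
  obtain ⟨K, hK, hΨ⟩ := isProfile_rpow hd hp (div_pos hp hr) he.le
  obtain ⟨C, hC, hb⟩ := quantError_le_of_moment hp hpq hK hΨ
  obtain ⟨C', hC', hs⟩ := sum_shell_le_critical (d := d) hp hpq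
  set r := q.toReal with hrdef
  refine ⟨(C * (1 / Real.log 2 ^ (p / d) + C')) ^ (1 / p), by positivity,
    fun N hN μ hμ R hR hM => ?_⟩
  have hm := lintegral_le_of_momentRoot_le hq0 hq hR hM
  obtain ⟨J, hJ, hbJ⟩ := hb N hN R hR μ hμ hm
  have hN1 : (1 : ℝ) ≤ N := by exact_mod_cast hN
  have hl : Real.log 2 ≤ Real.log (1 + N) := Real.log_le_log (by norm_num) (by linarith)
  have hl0 : 0 < Real.log (1 + N) := hl2.trans_le hl
  refine hbJ.trans (ofReal_rpow_one_div_le hp hR.le (by positivity) (by positivity) ?_)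
  have h1 := hs R hR μ hμ hm N J hN hJ
  rw [he'] at h1
  have h2 : p / r - 1 = -(p / d) := by linarith
  have h3 : ((N : ℝ) ^ (-1 / (d : ℝ)) * Real.log (1 + N) ^ (1 / (d : ℝ))) ^ p =
      (N : ℝ) ^ (-(p / d)) * Real.log (1 + N) ^ (p / d) := by
    rw [Real.mul_rpow (by positivity) (by positivity), ← Real.rpow_mul (by positivity),
      ← Real.rpow_mul hl0.le]
    congr 2 <;> ring
  rw [h2, h3]
  set L := Real.log (1 + N) ^ (p / d) with hL
  -- The cutoff term carries no logarithm; it is absorbed using `log 2 ≤ log (1 + N)`.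
  have h4 : 1 ≤ 1 / Real.log 2 ^ (p / d) * L := by
    rw [div_mul_eq_mul_div, one_mul, one_le_div (by positivity)]
    exact Real.rpow_le_rpow hl2.le hl (by positivity)
  calc _ ≤ C * R ^ p * ((N : ℝ) ^ (-(p / d)) * (1 / Real.log 2 ^ (p / d) * L) +
        (N : ℝ) ^ (-(p / d)) * (C' * L)) := by
        gcongr
        exact le_mul_of_one_le_right (by positivity) h4
    _ = _ := by ring

/-! ### The limit below the critical dimension -/

theorem tendsto_mul_quantError (hd : 1 ≤ d) (hq : q ≠ ∞) (hp : 0 < p) (hpq : p < q.toReal)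
    (hdp : (d : ℝ) < criticalDim p q) {μ : Measure (Space d)} (hμ : μ ∈ FiniteMoment d q) :
    Tendsto (fun N : ℕ => ENNReal.ofReal ((N : ℝ) ^ (1 / p - recip q)) * quantError N p μ)
      atTop (𝓝 0) := by
  have hr : 0 < q.toReal := hp.trans hpq
  have hq0 : q ≠ 0 := fun h => by simp [h] at hr
  have hlt := (lt_criticalDim_iff hd hq hp hpq).1 hdp
  rw [recip_eq_one_div]
  obtain ⟨hμp, hμm⟩ := hμ
  -- Adding `1` keeps `R` positive even for the Dirac mass at the origin.
  set R : ℝ := (momentRoot q μ).toReal + 1 with hRdef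
  have hR : 0 < R := by positivity
  have hM : momentRoot q μ ≤ ENNReal.ofReal R := by
    rw [← ENNReal.ofReal_toReal hμm.ne]
    exact ENNReal.ofReal_le_ofReal (by linarith)
  have hm := lintegral_le_of_momentRoot_le hq0 hq hR hM
  set r := q.toReal with hrdef
  obtain ⟨θ, hθ0, hθd, hθa⟩ := exists_exponent (div_pos hp hr) hlt
  obtain ⟨K, hK, hΨ⟩ := isProfile_rpow hd hp hθ0 hθd
  obtain ⟨C, hC, hb⟩ := quantError_le_scaled hp hpq hK hΨ
  obtain ⟨C', hC', hs⟩ := sum_shell_le_of_lt (d := d) hr hθ0 hθa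
  set F : ℝ → ℝ := fun ε => C * R ^ p * (ε ^ (p / r) + C' * ε ^ (p / r - θ)) with hF
  set G : ℝ → ℝ := fun ε => C * R ^ (p - r) * ε ^ (p / r - 1) with hG
  -- After normalization all powers of `N` cancel. `F` vanishes at `0` because `θ < p/r` strictly;
  -- `G` blows up there, but it multiplies a tail that tends to `0` once `ε` is fixed.
  have hbound : ∀ ε : ℝ, 0 < ε → ∀ N : ℕ, 1 ≤ N → 1 ≤ ε * N →
      (ENNReal.ofReal ((N : ℝ) ^ (1 / p - 1 / r)) * quantError N p μ) ^ p ≤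
        ENNReal.ofReal (F ε) +
          ENNReal.ofReal (G ε) * tailMoment r μ (R * ((ε * N) ^ (1 / r) / 2)) := by
    intro ε hε N hN hεN
    have hN0 : (0 : ℝ) < N := by exact_mod_cast hN
    obtain ⟨J, hJ, hbJ⟩ := hb N hN R hR μ hμp (ε * N) hεN
    rw [one_div p, ← ENNReal.rpow_inv_le_iff (inv_pos.2 hp), inv_inv] at hbJ
    rw [ENNReal.mul_rpow_of_nonneg _ _ hp.le, ENNReal.ofReal_rpow_of_pos (by positivity),
      ← Real.rpow_mul hN0.le]
    refine (mul_le_mul_right hbJ _).trans ?_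
    rw [mul_add, ← mul_assoc, ← ENNReal.ofReal_mul (by positivity),
      ← ENNReal.ofReal_mul (by positivity)]
    have e1 : (1 / p - 1 / r) * p = 1 - p / r := by field_simp
    have hNa : (N : ℝ) ^ (1 - p / r) * (N : ℝ) ^ (p / r - 1) = 1 := by
      rw [← Real.rpow_add hN0]; simp
    rw [e1]
    refine add_le_add (ENNReal.ofReal_le_ofReal ?_)
      (mul_le_mul_left (ENNReal.ofReal_le_ofReal (le_of_eq ?_)) _)
    · have h1 := hs R hR μ hμp hm (ε * N) J hJ
      have h2 : (ε * N) ^ (p / r) / (N : ℝ) = ε ^ (p / r) * (N : ℝ) ^ (p / r - 1) := by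
        rw [Real.mul_rpow hε.le hN0.le, Real.rpow_sub_one hN0.ne']; ring
      have h3 : (N : ℝ) ^ (θ - 1) * (C' * (ε * N) ^ (p / r - θ)) =
          C' * ε ^ (p / r - θ) * (N : ℝ) ^ (p / r - 1) := by
        rw [Real.mul_rpow hε.le hN0.le, show p / r - 1 = (θ - 1) + (p / r - θ) by ring,
          Real.rpow_add hN0]
        ring
      calc _ ≤ (N : ℝ) ^ (1 - p / r) * (C * R ^ p * ((ε * N) ^ (p / r) / N +
            (N : ℝ) ^ (θ - 1) * (C' * (ε * N) ^ (p / r - θ)))) := by gcongr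
        _ = F ε * ((N : ℝ) ^ (1 - p / r) * (N : ℝ) ^ (p / r - 1)) := by
            rw [h2, h3, hF]; ring
        _ = F ε := by rw [hNa, mul_one]
    · rw [Real.mul_rpow hε.le hN0.le]
      calc _ = G ε * ((N : ℝ) ^ (1 - p / r) * (N : ℝ) ^ (p / r - 1)) := by rw [hG]; ring
        _ = G ε := by rw [hNa, mul_one]
  have hpow : Tendsto (fun N : ℕ =>
      (ENNReal.ofReal ((N : ℝ) ^ (1 / p - 1 / r)) * quantError N p μ) ^ p) atTop (𝓝 0) := by
    rw [ENNReal.tendsto_nhds_zero]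
    intro η hη
    have hη2 : 0 < η / 2 := ENNReal.half_pos hη.ne'
    have hFlim : Tendsto (fun ε => ENNReal.ofReal (F ε)) (𝓝[>] 0) (𝓝 0) := by
      have h1 : Tendsto F (𝓝 0) (𝓝 (F 0)) := by
        refine Continuous.tendsto ?_ 0
        have c1 := Real.continuous_rpow_const (show 0 ≤ p / r by positivity)
        have c2 := Real.continuous_rpow_const (sub_pos.2 hθa).le
        fun_prop
      have h2 : F 0 = 0 := by
        simp only [hF]
        rw [Real.zero_rpow (by positivity), Real.zero_rpow (sub_pos.2 hθa).ne']
        simp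
      rw [h2] at h1
      have := (ENNReal.tendsto_ofReal h1).mono_left (nhdsWithin_le_nhds (s := Set.Ioi 0))
      simpa using this
    obtain ⟨ε, hεF, hε⟩ := (((ENNReal.tendsto_nhds_zero.1 hFlim) (η / 2) hη2).and
      self_mem_nhdsWithin).exists
    have hε : 0 < ε := hε
    have hεN : Tendsto (fun N : ℕ => ε * (N : ℝ)) atTop atTop :=
      tendsto_natCast_atTop_atTop.const_mul_atTop hε
    have hTlim : Tendsto (fun N : ℕ => ENNReal.ofReal (G ε) *
        tailMoment r μ (R * ((ε * N) ^ (1 / r) / 2))) atTop (𝓝 0) := by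
      have h1 : Tendsto (fun N : ℕ => R * ((ε * N) ^ (1 / r) / 2)) atTop atTop :=
        (((tendsto_rpow_atTop (by positivity)).comp hεN).atTop_div_const (by norm_num)).const_mul_atTop
          hR
      have h2 := (tendsto_tailMoment μ (ne_top_of_le_ne_top ENNReal.ofReal_ne_top hm)).comp h1
      simpa using ENNReal.Tendsto.const_mul h2 (Or.inr (ENNReal.ofReal_ne_top (r := G ε)))
    filter_upwards [(ENNReal.tendsto_nhds_zero.1 hTlim) (η / 2) hη2,
      hεN.eventually_ge_atTop 1, eventually_ge_atTop 1] with N h1 h2 h3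
    refine (hbound ε hε N h3 h2).trans ((add_le_add hεF h1).trans ?_)
    rw [ENNReal.add_halves]
  have h := (ENNReal.continuous_rpow_const (y := p⁻¹)).tendsto 0 |>.comp hpow
  rw [ENNReal.zero_rpow_of_pos (inv_pos.2 hp)] at h
  refine h.congr fun N => ?_
  simp only [Function.comp_apply]
  rw [ENNReal.rpow_rpow_inv hp.ne']

end UniformQuantization

theorem theorem1 (d : ℕ) (hd : 1 ≤ d) (p : ℝ) (q : ℝ≥0∞) (hp : 0 < p) (hpq : ENNReal.ofReal p < q) :
    (∃ C : ℝ, 0 < C ∧ ∀ N : ℕ, 1 ≤ N → ∀ μ ∈ UniformQuantization.FiniteMoment d q,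
      ((d : ℝ) ≠ UniformQuantization.criticalDim p q →
        UniformQuantization.quantError N p μ ≤
          ENNReal.ofReal C * UniformQuantization.momentRoot q μ *
            ENNReal.ofReal (max ((N : ℝ) ^ (-1 / (d : ℝ)))
              ((N : ℝ) ^ (-1 / p + UniformQuantization.recip q)))) ∧
      ((d : ℝ) = UniformQuantization.criticalDim p q →
        UniformQuantization.quantError N p μ ≤
          ENNReal.ofReal C * UniformQuantization.momentRoot q μ *
            ENNReal.ofReal ((N : ℝ) ^ (-1 / (d : ℝ)) *
              (Real.log (1 + (N : ℝ))) ^ (1 / (d : ℝ))))) ∧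
    (q < ∞ → (d : ℝ) < UniformQuantization.criticalDim p q →
      ∀ μ ∈ UniformQuantization.FiniteMoment d q,
        Tendsto (fun N : ℕ =>
            ENNReal.ofReal ((N : ℝ) ^ (1 / p - UniformQuantization.recip q)) *
              UniformQuantization.quantError N p μ)
          atTop (𝓝 0)) := by
  have hpq' : q ≠ ∞ → p < q.toReal := fun hq => (ENNReal.ofReal_lt_iff_lt_toReal hp.le hq).1 hpq
  refine ⟨?_, fun hq hdp μ hμ =>
    UniformQuantization.tendsto_mul_quantError hd hq.ne hp (hpq' hq.ne) hdp hμ⟩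
  -- The alternative depends on `d`, `p`, `q` only, so it may be settled before `C` is chosen.
  by_cases hc : (d : ℝ) = UniformQuantization.criticalDim p q
  · obtain ⟨C, hC, h⟩ := UniformQuantization.HasRate.le_momentRoot (d := d) (p := p) (q := q)
      (ρ := fun N => (N : ℝ) ^ (-1 / (d : ℝ)) * Real.log (1 + N) ^ (1 / (d : ℝ))) (by
        by_cases hq : q = ∞
        · subst hq
          exact UniformQuantization.hasRate_top_critical hd hp
            (by simpa [UniformQuantization.criticalDim] using hc)
        · exact UniformQuantization.hasRate_critical hd hq hp (hpq' hq) hc)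
    exact ⟨C, hC, fun N hN μ hμ => ⟨fun hn => absurd hc hn, fun _ => h N hN μ hμ⟩⟩
  · obtain ⟨C, hC, h⟩ := UniformQuantization.HasRate.le_momentRoot (d := d) (p := p) (q := q)
      (ρ := fun N => max ((N : ℝ) ^ (-1 / (d : ℝ)))
        ((N : ℝ) ^ (-1 / p + UniformQuantization.recip q))) (by
        by_cases hq : q = ∞
        · subst hq
          exact UniformQuantization.hasRate_top_of_ne hd hp
            (by simpa [UniformQuantization.criticalDim] using hc)
        · exact UniformQuantization.hasRate_of_ne hd hq hp (hpq' hq) hc)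
    exact ⟨C, hC, fun N hN μ hμ => ⟨fun _ => h N hN μ hμ, fun hn => absurd hn hc⟩⟩
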